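/- Let $\mathbb{F}_q$ be a finite field, $n\ge 2$, let $\sigma$ be a generator of $\mathrm{Gal}(\mathbb{F}_{q^n}/\mathbb{F}_q)$, and let $R=\mathbb{F}_{q^n}[x;\sigma]$ be the skew polynomial ring with $x\alpha=\sigma(\alpha)x$ for $\alpha\in\mathbb{F}_{q^n}$. Let $F(y)\in\mathbb{F}_q[y]$ be a monic irreducible polynomial of degree $s$ with constant coefficient $F_0\neq 0$, let $\hat F(y)=F_0^{-1}y^sF(1/y)$ be its monic reciprocal polynomial, and put $R_F=R/RF(x^n)$ and $R_{\hat F}=R/R\hat F(x^n)$. Let $1\le k<n$. For $1\le j<n$, $\eta\in\mathbb{F}_{q^n}$, $\rho\in\mathrm{Aut}(\mathbb{F}_{q^n})$ and $G\in\{F,\hat F\}$ let $$S_{n,s,j}(\eta,\rho,G)=\Big\{a_0+\sum_{i=1}^{sj-1}a_ix^i+\eta\rho(a_0)x^{sj}+RG(x^n)\;:\;a_i\in\mathbb{F}_{q^n}\Big\}\subseteq R_G,$$ and, if $n=2t$ is even and $\gamma\in\mathbb{F}_{q^n}$, let $$D_{n,s,j}(\gamma,G)=\Big\{a'+\sum_{i=1}^{sj-1}a_ix^i+\gamma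 a''x^{sj}+RG(x^n)\;:\;a_i\in\mathbb{F}_{q^n},\ a',a''\in\mathbb{F}_{q^t}\Big\}\subseteq R_G.$$ The dual of a set $\mathcal{C}\subseteq M_n(\mathbb{F}_{q^s})$ is $\mathcal{C}^\perp=\{Y\in M_n(\mathbb{F}_{q^s}) : \mathrm{Tr}_{\mathbb{F}_{q^s}/\mathbb{F}_p}(\mathrm{Tr}(XY^\top))=0 \text{ for all } X\in\mathcal{C}\}$, where $\mathbb{F}_p$ is the prime field. Two sets $\mathcal{C},\mathcal{C}'\subseteq M_n(\mathbb{F}_{q^s})$ are equivalent if $\mathcal{C}'=\{UA^{\tau}V : A\in\mathcal{C}\}$ for some $U,V\in\mathrm{GL}_n(\mathbb{F}_{q^s})$ and some $\tau\in\mathrm{Aut}(\mathbb{F}_{q^s})$ applied entrywise. Then the rings $R_F$ and $R_{\hat F}$ are both isomorphic to $M_n(\mathbb{F}_{q^s})$, and for all ring isomorphisms $m:R_F\to M_n(\mathbb{F}_{q^s})$ and $m':R_{\hat F}\to M_n(\mathbb{F}_{q^s})$ the following hold. 1. For every $\eta\in\mathbb{F}_{q^n}$ and every $\rho\in\mathrm{Aut}(\mathbb{F}_{q^n})$,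 the dual of $m\big(S_{n,s,k}(\eta,\rho,F)\big)$ is equivalent to $m'\big(S_{n,s,n-k}(\rho^{-1}(\eta F_0),\rho^{-1},\hat F)\big)$. 2. If $n$ is even, then for every nonzero $\gamma\in\mathbb{F}_{q^n}$, the dual of $m\big(D_{n,s,k}(\gamma,F)\big)$ is equivalent to $m'\big(D_{n,s,n-k}(\sigma^{sk}(\gamma),\hat F)\big)$. -/

import Mathlib

open Polynomial

noncomputable section

/-- A copy of the field `L`, used as the coefficient field of the skew polynomial ring `L[x; σ]`:
it carries the action of `ℕ` through the powers of `σ` which Mathlib's `SkewPolynomial` reads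
as the twist of the multiplication. -/
def SkewCoeff {K L : Type*} [Field K] [Field L] [Algebra K L] (_σ : L ≃ₐ[K] L) : Type _ := L

instance {K L : Type*} [Field K] [Field L] [Algebra K L] (σ : L ≃ₐ[K] L) :
    Field (SkewCoeff σ) := inferInstanceAs (Field L)

instance {K L : Type*} [Field K] [Field L] [Algebra K L] (σ : L ≃ₐ[K] L) :
    MulSemiringAction (Multiplicative ℕ) (SkewCoeff σ) :=
  MulSemiringAction.compHom L (powersHom (L ≃ₐ[K] L) σ)

/-- The skew polynomial ring `R = L[x; σ]`: coefficients on the left, `x * a = σ(a) * x`. -/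
abbrev SkewRing {K L : Type*} [Field K] [Field L] [Algebra K L] (σ : L ≃ₐ[K] L) : Type _ :=
  SkewPolynomial (SkewCoeff σ)

/-- The skew monomial `a x^i`. -/
def skewMonomial {K L : Type*} [Field K] [Field L] [Algebra K L] (σ : L ≃ₐ[K] L)
    (i : ℕ) (a : L) : SkewRing σ :=
  SkewPolynomial.monomial (R := SkewCoeff σ) i a

/-- The defining rule `x * a = σ(a) * x` of `L[x; σ]`. -/
theorem skewMonomial_X_mul_C {K L : Type*} [Field K] [Field L] [Algebra K L] (σ : L ≃ₐ[K] L)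
    (a : L) :
    skewMonomial σ 1 1 * skewMonomial σ 0 a = skewMonomial σ 0 (σ a) * skewMonomial σ 1 1 := by
  have h : skewMonomial σ 1 1 * skewMonomial σ 0 a = skewMonomial σ 1 (1 * σ a) :=
    SkewPolynomial.monomial_mul_monomial (R := SkewCoeff σ) 1 0 1 a
  have h' : skewMonomial σ 0 (σ a) * skewMonomial σ 1 1 = skewMonomial σ 1 (σ a * 1) :=
    SkewPolynomial.monomial_mul_monomial (R := SkewCoeff σ) 0 1 (σ a) 1
  rw [h, h', one_mul, mul_one]

/-- The element `F(x^n) = ∑ F_i x^(n i)` of `L[x; σ]`, for `F ∈ K[y]`. -/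
def evalXPow {K L : Type*} [Field K] [Field L] [Algebra K L] (σ : L ≃ₐ[K] L)
    (n : ℕ) (F : K[X]) : SkewRing σ :=
  F.sum fun i c => skewMonomial σ (n * i) (algebraMap K L c)

/-- The quotient ring `R_F = R / R F(x^n)`. It is formed with the two-sided ideal generated by
`F(x^n)`, which is `R F(x^n)` whenever `F(x^n)` is central (that is the case if `σ ^ n = 1`). -/
abbrev SkewQuot {K L : Type*} [Field K] [Field L] [Algebra K L] (σ : L ≃ₐ[K] L)
    (n : ℕ) (F : K[X]) : Type _ :=
  (TwoSidedIdeal.span ({evalXPow σ n F} : Set (SkewRing σ))).ringCon.Quotient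

/-- The canonical projection `R → R_F`. -/
def SkewQuot.mk {K L : Type*} [Field K] [Field L] [Algebra K L] (σ : L ≃ₐ[K] L)
    (n : ℕ) (F : K[X]) : SkewRing σ →+* SkewQuot σ n F :=
  (TwoSidedIdeal.span ({evalXPow σ n F} : Set (SkewRing σ))).ringCon.mk'

/-- The monic reciprocal polynomial `F_0⁻¹ y^s F(1/y)` of a polynomial `F` of degree `s` with
constant coefficient `F_0 ≠ 0`. -/
def monicReciprocal {K : Type*} [Field K] (F : K[X]) : K[X] :=
  C (F.coeff 0)⁻¹ * F.reverse

/-- The subset `S_{n,s,k}(η,ρ,F)` of `R_F`: the classes of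
`a_0 + ∑_{i=1}^{sk-1} a_i x^i + η ρ(a_0) x^{sk}` with all `a_i ∈ L`. -/
def codeS {K L : Type*} [Field K] [Field L] [Algebra K L] (σ : L ≃ₐ[K] L)
    (n s k : ℕ) (η : L) (ρ : L ≃+* L) (F : K[X]) : Set (SkewQuot σ n F) :=
  {b | ∃ a : ℕ → L, b = SkewQuot.mk σ n F
    (skewMonomial σ 0 (a 0) + ∑ i ∈ Finset.Ico 1 (s * k), skewMonomial σ i (a i)
      + skewMonomial σ (s * k) (η * ρ (a 0)))}

/-- The subset `D_{n,s,k}(γ,F)` of `R_F`: the classes of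
`a' + ∑_{i=1}^{sk-1} a_i x^i + γ a'' x^{sk}` with all `a_i ∈ L` and `a', a'' ∈ M`, where `M` is the
intermediate field of `L / K` with `[L : M] = 2`. -/
def codeD {K L : Type*} [Field K] [Field L] [Algebra K L] (σ : L ≃ₐ[K] L)
    (M : IntermediateField K L) (n s k : ℕ) (γ : L) (F : K[X]) : Set (SkewQuot σ n F) :=
  {b | ∃ (a' a'' : M) (a : ℕ → L), b = SkewQuot.mk σ n F
    (skewMonomial σ 0 (a' : L) + ∑ i ∈ Finset.Ico 1 (s * k), skewMonomial σ i (a i)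
      + skewMonomial σ (s * k) (γ * (a'' : L)))}

/-- The dual code `{Y | Tr_{E/E'}(Tr(X Yᵀ)) = 0 for all X ∈ C}` of a rank-metric code `C`, where
`E'` (in Mathlib `⊥ : Subfield E`) is the prime subfield of `E`. -/
def dualCode {E : Type*} [Field E] {n : ℕ} (C : Set (Matrix (Fin n) (Fin n) E)) :
    Set (Matrix (Fin n) (Fin n) E) :=
  {Y | ∀ X ∈ C, Algebra.trace (⊥ : Subfield E) E (Matrix.trace (X * Y.transpose)) = 0}

/-- Equivalence of rank-metric codes: `C' = {U A^τ V | A ∈ C}` with `U, V ∈ GL_n(E)` and a field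
automorphism `τ` of `E` applied to all entries. -/
def CodeEquivalent {E : Type*} [Field E] {n : ℕ} (C C' : Set (Matrix (Fin n) (Fin n) E)) : Prop :=
  ∃ (U V : (Matrix (Fin n) (Fin n) E)ˣ) (τ : E ≃+* E),
    C' = (fun A : Matrix (Fin n) (Fin n) E =>
      (U : Matrix (Fin n) (Fin n) E) * A.map τ * (V : Matrix (Fin n) (Fin n) E)) '' C

end

/-!
Write `R_G = L[x; σ] / (G(x ^ n))`, and let `s` be the degree of `F`. The computation takes place
in `R_F` and in the quotient ring of the reciprocal polynomial; matrices enter only through two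
general facts.

*Trace form.* The functional `constCoeff` on `R_F` reads off the constant coefficient of the
representative of degree less than `n s`. It is defined through remainders modulo `F` of powers of
`y = x ^ n`. Followed by the trace of `L` over the prime field, it is a nonzero trace functional
`T`, that is `T (a b) = T (b a)` (`constCoeff_mul_comm`). Under an isomorphism `R_F ≅ M_n(E)`
every such functional has the form `X ↦ Tr(z tr X)` with `z ∈ E` (`exists_eq_trace`,
`exists_eq_trace_mul`), so the dual of a code is determined by its orthogonal with respect to `T`.

*Orthogonals.* All codes consist of the classes of `∑_{i ≤ N} a_i x ^ i` whose end coefficients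
are subject to a condition `Q (a_0) (a_N)` (`polyCode`). If `N + N' = n s`, the pairing of
`∑_{i ≤ N} a_i x ^ i` with `∑_{j ≤ N'} b_j x ^ j` is `a_0 b_0 - F_0 a_N σ ^ N (b_{N'})`: only the
exponents `0` and `n s` contribute, and `y ^ s` has constant coefficient `-F_0` modulo `F`
(`constCoeff_polySum_mul_polySum`). Together with a triangular system that bounds the degree of an
orthogonal element (`coeff_eq_zero_of_constCoeff`), this identifies the orthogonal with the
`polyCode` of degree `N'` for the orthogonal boundary condition (`orthogonal_polyCode`).

*Passage to the reciprocal polynomial.* The substitution `a x ^ i ↦ x ^ (-i) a` is an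
anti-homomorphism from `R_F` to the quotient ring of the reciprocal polynomial, and multiplying by
`x ^ N'` turns the image of the orthogonal into a code with reversed coefficients
(`antiHom_polyCode`). On the matrix side an anti-homomorphism is the transposition followed by a
ring automorphism of `M_n(E)`, which is semilinear conjugation by Skolem-Noether
(`exists_conj_map`). Hence the dual and this code are equivalent
(`codeEquivalent_dualCode_polyCode`), and it remains to solve the orthogonal boundary condition
for the two families.

*Matrix rings.* `R_G` is simple (`one_mem_of_mem`) and its center is `K[y] / (G)` (`center_quot`);
the theorems of Wedderburn and Artin and a count of elements give `R_G ≅ M_n(E)`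
(`nonempty_ringEquiv`).
-/

/-! ### The quotient ring and its monomials -/

namespace SkewQuot

variable {K L : Type*} [Field K] [Field L] [Algebra K L] (σ : L ≃ₐ[K] L)

theorem skewMonomial_mul (i j : ℕ) (a b : L) :
    skewMonomial σ i a * skewMonomial σ j b = skewMonomial σ (i + j) (a * (σ ^ i) b) :=
  SkewMonoidAlgebra.single_mul_single (k := SkewCoeff σ) (a₁ := Multiplicative.ofAdd i)
    (a₂ := Multiplicative.ofAdd j)

theorem skewMonomial_add (i : ℕ) (a b : L) :
    skewMonomial σ i (a + b) = skewMonomial σ i a + skewMonomial σ i b :=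
  map_add (SkewPolynomial.monomial (R := SkewCoeff σ) i) a b

@[simp]
theorem skewMonomial_zero (i : ℕ) : skewMonomial σ i 0 = 0 :=
  SkewPolynomial.monomial_zero_right (R := SkewCoeff σ) i

theorem skewMonomial_one : skewMonomial σ 0 1 = 1 := rfl

theorem skewRing_induction {motive : SkewRing σ → Prop} (p : SkewRing σ) (h0 : motive 0)
    (hadd : ∀ p q, motive p → motive q → motive (p + q))
    (hmon : ∀ i a, motive (skewMonomial σ i a)) : motive p :=
  SkewMonoidAlgebra.induction_on (G := Multiplicative ℕ) p h0 (fun i a => hmon i.toAdd a) (fun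
      {p q} => hadd p q)

/-- The additive map `SkewRing σ → M` with prescribed values `a ↦ f (a x ^ i)`. -/
noncomputable def skewLift {M : Type*} [AddCommMonoid M] (f : ℕ → L →+ M) : SkewRing σ →+ M where
  toFun p := SkewPolynomial.sum p (fun i a => f i a)
  map_zero' := SkewPolynomial.sum_zero_index _
  map_add' p q := SkewPolynomial.sum_add_index p q _ (fun i => map_zero (f i))
    (fun i a b => map_add (f i) a b)

theorem skewLift_skewMonomial {M : Type*} [AddCommMonoid M] (f : ℕ → L →+ M) (i : ℕ) (a : L) :
    skewLift σ f (skewMonomial σ i a) = f i a :=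
  SkewPolynomial.sum_monomial_index (R := SkewCoeff σ) (b := a) (h := fun i a => f i a)
    (map_zero (f i))

variable (n : ℕ) (G : K[X])

/-- The class of `a x ^ i` in `R_G`. -/
noncomputable def mon (i : ℕ) : L →+ SkewQuot σ n G where
  toFun a := mk σ n G (skewMonomial σ i a)
  map_zero' := by simp
  map_add' a b := by rw [skewMonomial_add, map_add]

theorem mk_skewMonomial (i : ℕ) (a : L) : mk σ n G (skewMonomial σ i a) = mon σ n G i a := rfl

theorem mk_surjective : Function.Surjective (mk σ n G) :=
  RingCon.mk'_surjective _

theorem mon_mul_mon (i j : ℕ) (a b : L) :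
    mon σ n G i a * mon σ n G j b = mon σ n G (i + j) (a * (σ ^ i) b) := by
  rw [← mk_skewMonomial, ← mk_skewMonomial, ← map_mul, skewMonomial_mul, mk_skewMonomial]

@[simp]
theorem mon_zero_one : mon σ n G 0 1 = 1 := by
  rw [← mk_skewMonomial, skewMonomial_one, map_one]

theorem quot_induction {motive : SkewQuot σ n G → Prop} (p : SkewQuot σ n G) (h0 : motive 0)
    (hadd : ∀ p q, motive p → motive q → motive (p + q))
    (hmon : ∀ i a, motive (mon σ n G i a)) : motive p := by
  obtain ⟨p, rfl⟩ := mk_surjective σ n G p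
  induction p using skewRing_induction with
  | h0 => simpa using h0
  | hadd p q hp hq => rw [map_add]; exact hadd _ _ hp hq
  | hmon i a => exact hmon i a

theorem mon_pow (i l : ℕ) : mon σ n G i 1 ^ l = mon σ n G (i * l) 1 := by
  induction l with
  | zero => simp
  | succ l ih => rw [pow_succ, ih, mon_mul_mon]; simp [Nat.mul_succ]

theorem mk_evalXPow (P : K[X]) :
    mk σ n G (evalXPow σ n P) = P.sum fun i c => mon σ n G (n * i) (algebraMap K L c) := by
  exact map_sum (mk σ n G) _ _

theorem mk_evalXPow_self : mk σ n G (evalXPow σ n G) = 0 := by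
  have : evalXPow σ n G ∈ TwoSidedIdeal.span ({evalXPow σ n G} : Set (SkewRing σ)) :=
    TwoSidedIdeal.subset_span rfl
  rw [← map_zero (mk σ n G)]
  exact (RingCon.eq _).2 this

theorem mk_eq_zero_iff {p : SkewRing σ} : mk σ n G p = 0 ↔
    p ∈ TwoSidedIdeal.span ({evalXPow σ n G} : Set (SkewRing σ)) := by
  rw [← map_zero (mk σ n G)]
  exact (RingCon.eq _)

/-- The ring homomorphism `K[y] → R_G`, `P ↦ P(x ^ n)`. -/
noncomputable def polyHom : K[X] →+* SkewQuot σ n G :=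
  eval₂RingHom'
    { toFun c := mon σ n G 0 (algebraMap K L c)
      map_zero' := by simp
      map_one' := by simp
      map_add' a b := by simp
      map_mul' a b := by simp [mon_mul_mon] }
    (mon σ n G n 1) (fun c => by
      change mon σ n G 0 (algebraMap K L c) * _ = _ * mon σ n G 0 (algebraMap K L c)
      simp [mon_mul_mon])

theorem polyHom_apply (P : K[X]) :
    polyHom σ n G P = P.sum fun i c => mon σ n G (n * i) (algebraMap K L c) := by
  change eval₂ _ _ P = _
  rw [eval₂_eq_sum]
  congr 1
  ext i c
  change mon σ n G 0 (algebraMap K L c) * _ = _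
  rw [mon_pow, mon_mul_mon]; simp

theorem polyHom_eq_mk (P : K[X]) : polyHom σ n G P = mk σ n G (evalXPow σ n P) := by
  rw [polyHom_apply, mk_evalXPow]

@[simp]
theorem polyHom_self : polyHom σ n G G = 0 := by rw [polyHom_eq_mk, mk_evalXPow_self]

theorem polyHom_C_mul_X_pow (c : K) (l : ℕ) :
    polyHom σ n G (C c * X ^ l) = mon σ n G (n * l) (algebraMap K L c) := by
  rw [polyHom_apply, C_mul_X_pow_eq_monomial, sum_monomial_index]; simp
end SkewQuot

/-! ### The constant coefficient functional -/

namespace SkewQuot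

variable {K L : Type*} [Field K] [Field L] [Algebra K L] (σ : L ≃ₐ[K] L) (n : ℕ) (G : K[X])

/-- The constant coefficient of the remainder of `P` modulo `G`, as a linear functional. -/
noncomputable def remCoeff : K[X] →ₗ[K] K := lcoeff K 0 ∘ₗ modByMonicHom G

theorem remCoeff_apply (P : K[X]) : remCoeff G P = (P %ₘ G).coeff 0 := rfl

variable {G}

theorem remCoeff_mul_self (hG : G.Monic) (P : K[X]) : remCoeff G (P * G) = 0 := by
  rw [remCoeff_apply, (modByMonic_eq_zero_iff_dvd hG).2 (dvd_mul_left G P), coeff_zero]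

theorem remCoeff_X_pow_of_lt (hG : G.Monic) {l : ℕ} (hl : l < G.natDegree) :
    remCoeff G (X ^ l) = if l = 0 then 1 else 0 := by
  rw [remCoeff_apply, (modByMonic_eq_self_iff hG).2, coeff_X_pow]
  · simp [eq_comm]
  · rw [degree_X_pow, degree_eq_natDegree hG.ne_zero]; exact_mod_cast hl

theorem remCoeff_X_pow_natDegree (hG : G.Monic) (h0 : 0 < G.natDegree) :
    remCoeff G (X ^ G.natDegree) = -G.coeff 0 := by
  have h1 : (X ^ G.natDegree : K[X]) = (X ^ G.natDegree - G) + 1 * G := by ring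
  rw [h1, map_add, remCoeff_mul_self hG, add_zero, remCoeff_apply, (modByMonic_eq_self_iff hG).2]
  · simp [coeff_X_pow, h0.ne]
  · have := degree_sub_lt_left (p := (X ^ G.natDegree : K[X])) (q := G)
      (by rw [degree_X_pow, degree_eq_natDegree hG.ne_zero]) (pow_ne_zero _ X_ne_zero)
      (by rw [(monic_X_pow _).leadingCoeff, hG.leadingCoeff])
    rwa [degree_X_pow, ← degree_eq_natDegree hG.ne_zero] at this

variable (G)

/-- The constant coefficient functional before passing to the quotient: `a x ^ (n l)` is sent to
`a` times the constant coefficient of `y ^ l` modulo `G`, the other monomials are sent to `0`. -/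
noncomputable def preConstCoeff : SkewRing σ →+ L :=
  skewLift σ fun i => if n ∣ i then
    AddMonoidHom.mulRight (algebraMap K L (remCoeff G (X ^ (i / n)))) else 0

theorem preConstCoeff_skewMonomial (i : ℕ) (a : L) :
    preConstCoeff σ n G (skewMonomial σ i a) =
      if n ∣ i then a * algebraMap K L (remCoeff G (X ^ (i / n))) else 0 := by
  rw [preConstCoeff, skewLift_skewMonomial]
  split_ifs <;> rfl

variable {σ n G}

theorem pow_mul_apply_eq (hσ : σ ^ n = 1) (l : ℕ) (a : L) : (σ ^ (n * l)) a = a := by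
  rw [pow_mul, hσ, one_pow, AlgEquiv.one_apply]

theorem preConstCoeff_monomial_mul (hσ : σ ^ n = 1) (hn : 0 < n) (hG : G.Monic) (i j : ℕ)
    (a b : L) :
    preConstCoeff σ n G (skewMonomial σ i a * evalXPow σ n G * skewMonomial σ j b) = 0 := by
  have h : ∀ l c, preConstCoeff σ n G
      (skewMonomial σ i a * skewMonomial σ (n * l) (algebraMap K L c) * skewMonomial σ j b) =
      if n ∣ i + j then
        a * (σ ^ i) b * algebraMap K L (remCoeff G (X ^ ((i + j) / n) * (C c * X ^ l))) else 0 := by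
    intro l c
    rw [skewMonomial_mul, skewMonomial_mul, preConstCoeff_skewMonomial, AlgEquiv.commutes,
      show i + n * l + j = (i + j) + n * l by ring, pow_add, AlgEquiv.mul_apply,
      pow_mul_apply_eq hσ, Nat.add_mul_div_left _ _ hn]
    simp_rw [← Nat.dvd_add_iff_left (dvd_mul_right n l)]
    split_ifs
    · rw [mul_left_comm, ← pow_add, C_mul', LinearMap.map_smul, smul_eq_mul, map_mul]; ring
    · rfl
  rw [evalXPow, Polynomial.sum, Finset.mul_sum, Finset.sum_mul, map_sum]
  simp_rw [h]
  split_ifs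
  · rw [← Finset.mul_sum, ← map_sum, ← map_sum, ← Finset.mul_sum, ← as_sum_support_C_mul_X_pow,
      remCoeff_mul_self hG, map_zero, mul_zero]
  · simp

theorem preConstCoeff_mul (hσ : σ ^ n = 1) (hn : 0 < n) (hG : G.Monic) (p q : SkewRing σ) :
    preConstCoeff σ n G (p * evalXPow σ n G * q) = 0 := by
  induction p using skewRing_induction with
  | h0 => simp
  | hadd p p' hp hp' => rw [add_mul, add_mul, map_add, hp, hp', add_zero]
  | hmon i a =>
    induction q using skewRing_induction with
    | h0 => simp
    | hadd q q' hq hq' => rw [mul_add, map_add, hq, hq', add_zero]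
    | hmon j b => exact preConstCoeff_monomial_mul hσ hn hG i j a b

theorem preConstCoeff_of_mk_eq_zero (hσ : σ ^ n = 1) (hn : 0 < n) (hG : G.Monic) {p : SkewRing σ}
    (hp : mk σ n G p = 0) : preConstCoeff σ n G p = 0 := by
  rw [mk_eq_zero_iff, TwoSidedIdeal.mem_span_iff_mem_addSubgroup_closure] at hp
  induction hp using AddSubgroup.closure_induction with
  | mem x hx =>
    obtain ⟨y, ⟨r, -, g, rfl, rfl⟩, r', -, rfl⟩ := hx
    exact preConstCoeff_mul hσ hn hG r r'
  | zero => exact map_zero _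
  | add x y _ _ hx hy => rw [map_add, hx, hy, add_zero]
  | neg x _ hx => rw [map_neg, hx, neg_zero]

/-- The functional on `R_G` reading off the constant coefficient of the representative of degree
less than `n * deg G`. -/
noncomputable def constCoeff (hσ : σ ^ n = 1) (hn : 0 < n) (hG : G.Monic) : SkewQuot σ n G →+ L :=
  (mk σ n G).toAddMonoidHom.liftOfSurjective (mk_surjective σ n G)
    ⟨preConstCoeff σ n G, fun _ hp => preConstCoeff_of_mk_eq_zero hσ hn hG hp⟩

theorem constCoeff_mon (hσ : σ ^ n = 1) (hn : 0 < n) (hG : G.Monic) (i : ℕ) (a : L) :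
    constCoeff hσ hn hG (mon σ n G i a) =
      if n ∣ i then a * algebraMap K L (remCoeff G (X ^ (i / n))) else 0 := by
  rw [← preConstCoeff_skewMonomial]
  exact AddMonoidHom.liftOfRightInverse_comp_apply _ _ _ _ _

theorem constCoeff_mon_zero_mul (hσ : σ ^ n = 1) (hn : 0 < n) (hG : G.Monic) (a : L)
    (b : SkewQuot σ n G) :
    constCoeff hσ hn hG (mon σ n G 0 a * b) = a * constCoeff hσ hn hG b := by
  induction b using quot_induction with
  | h0 => simp
  | hadd p q hp hq => rw [mul_add, map_add, map_add, hp, hq, mul_add]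
  | hmon i c =>
    rw [mon_mul_mon, constCoeff_mon, constCoeff_mon, zero_add, pow_zero, AlgEquiv.one_apply]
    split_ifs <;> ring

/-- The constant coefficient followed by a `σ`-invariant functional is a trace: it does not
distinguish `a * b` from `b * a`. -/
theorem constCoeff_mul_comm (hσ : σ ^ n = 1) (hn : 0 < n) (hG : G.Monic) {P : Type*}
    [AddCommGroup P] (t : L →+ P) (ht : ∀ a, t (σ a) = t a) (a b : SkewQuot σ n G) :
    t (constCoeff hσ hn hG (a * b)) = t (constCoeff hσ hn hG (b * a)) := by
  have hti : ∀ i a, t ((σ ^ i) a) = t a := fun i => by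
    induction i with
    | zero => simp
    | succ i ih => intro a; rw [pow_succ, AlgEquiv.mul_apply, ih, ht]
  induction a using quot_induction with
  | h0 => simp
  | hadd p q hp hq => rw [mul_add, add_mul, map_add, map_add, map_add, map_add, hp, hq]
  | hmon i a =>
    induction b using quot_induction with
    | h0 => simp
    | hadd p q hp hq => rw [mul_add, add_mul, map_add, map_add, map_add, map_add, hp, hq]
    | hmon j b =>
      rw [mon_mul_mon, mon_mul_mon, constCoeff_mon, constCoeff_mon, add_comm j i]
      split_ifs with h
      · obtain ⟨l, hl⟩ := h
        rw [← hti i (b * _ * _), map_mul (σ ^ i), map_mul (σ ^ i), AlgEquiv.commutes, ←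
            AlgEquiv.mul_apply, ← pow_add,
          hl, pow_mul_apply_eq hσ, mul_comm a]
      · rfl

variable (σ n G) in
/-- The map `(a_i) ↦ ∑_{i < N} a_i x ^ i`. -/
noncomputable def polySum (N : ℕ) : (ℕ → L) →+ SkewQuot σ n G :=
  ∑ i ∈ Finset.range N, (mon σ n G i).comp (Pi.evalAddMonoidHom (fun _ => L) i)

theorem polySum_apply (N : ℕ) (a : ℕ → L) :
    polySum σ n G N a = ∑ i ∈ Finset.range N, mon σ n G i (a i) := by
  simp [polySum]

theorem constCoeff_mon_mul_polySum (hσ : σ ^ n = 1) (hn : 0 < n) (hG : G.Monic) (i : ℕ) (a : L)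
    (N : ℕ) (b : ℕ → L) :
    constCoeff hσ hn hG (mon σ n G i a * polySum σ n G N b) =
      ∑ j ∈ Finset.range N, if n ∣ i + j then
        a * (σ ^ i) (b j) * algebraMap K L (remCoeff G (X ^ ((i + j) / n))) else 0 := by
  rw [polySum_apply, Finset.mul_sum, map_sum]
  refine Finset.sum_congr rfl fun j _ => ?_
  rw [mon_mul_mon, constCoeff_mon]

theorem remCoeff_term (hG : G.Monic) {m : ℕ} (hm : 0 < m) (hmn : m < n * G.natDegree)
    (hdvd : n ∣ m) : remCoeff G (X ^ (m / n)) = 0 := by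
  obtain ⟨l, rfl⟩ := hdvd
  have hn : 0 < n := Nat.pos_of_mul_pos_right hm
  rw [Nat.mul_div_cancel_left _ hn, remCoeff_X_pow_of_lt hG (Nat.lt_of_mul_lt_mul_left hmn),
    if_neg (by rintro rfl; simp at hm)]

/-- If `b = ∑_j b_j x ^ j` has degree less than `n * deg G`, and `x ^ i b` has constant
coefficient `0` for `1 ≤ i ≤ m`, then the top `m` coefficients of `b` vanish: the condition for `x
^ i` involves, besides coefficients already known to vanish, only the coefficient of `x ^ (n * deg
G - i)`. -/
theorem coeff_eq_zero_of_constCoeff (hσ : σ ^ n = 1) (hn : 0 < n) (hG : G.Monic)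
    (hG0 : G.coeff 0 ≠ 0) (hGd : 0 < G.natDegree) (b : ℕ → L) (m : ℕ) (hm : m < n * G.natDegree)
    (h : ∀ i, 1 ≤ i → i ≤ m →
      constCoeff hσ hn hG (mon σ n G i 1 * polySum σ n G (n * G.natDegree) b) = 0) :
    ∀ r, 1 ≤ r → r ≤ m → b (n * G.natDegree - r) = 0 := by
  intro r
  induction r using Nat.strong_induction_on with
  | _ r ih =>
    intro hr1 hrm
    have h1 := h r hr1 hrm
    -- exponents below `n * deg G` contribute nothing, those above come with vanishing coefficients
    rw [constCoeff_mon_mul_polySum, Finset.sum_eq_single (n * G.natDegree - r)] at h1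
    · rw [if_pos (by rw [Nat.add_sub_cancel' (hrm.trans hm.le)]; exact dvd_mul_right _ _),
        Nat.add_sub_cancel' (hrm.trans hm.le), Nat.mul_div_cancel_left _ hn,
        remCoeff_X_pow_natDegree hG hGd] at h1
      rw [one_mul, mul_eq_zero, map_neg, neg_eq_zero, map_eq_zero] at h1
      exact h1.resolve_right (by simpa using hG0)
    · intro j hj hjr
      rw [Finset.mem_range] at hj
      rcases lt_or_gt_of_ne hjr with hlt | hgt
      · split_ifs with hd
        · rw [remCoeff_term hG (by omega) (by omega) hd, map_zero, mul_zero]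
        · rfl
      · have := ih (n * G.natDegree - j) (by omega) (by omega) (by omega)
        rw [Nat.sub_sub_self hj.le] at this
        simp [this]
    · intro hn'; exact absurd (Finset.mem_range.2 (by omega)) hn'

theorem polySum_eq_zero (hσ : σ ^ n = 1) (hn : 0 < n) (hG : G.Monic)
    (hG0 : G.coeff 0 ≠ 0) (hGd : 0 < G.natDegree) (b : ℕ → L)
    (h : polySum σ n G (n * G.natDegree) b = 0) : ∀ j < n * G.natDegree, b j = 0 := by
  have hpos : 0 < n * G.natDegree := Nat.mul_pos hn hGd
  intro j hj
  rcases Nat.eq_zero_or_pos j with rfl | hj0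
  · have h1 := constCoeff_mon_mul_polySum hσ hn hG 0 1 (n * G.natDegree) b
    rw [h, mul_zero, map_zero, Finset.sum_eq_single 0] at h1
    · rw [Nat.zero_add, Nat.zero_div, remCoeff_X_pow_of_lt hG hGd] at h1
      simpa using h1.symm
    · intro i hi hi0
      rw [Finset.mem_range] at hi
      split_ifs with hd
      · rw [remCoeff_term hG (by omega) (by omega) hd, map_zero, mul_zero]
      · rfl
    · intro hn'; exact absurd (Finset.mem_range.2 hpos) hn'
  · have := coeff_eq_zero_of_constCoeff hσ hn hG hG0 hGd b (n * G.natDegree - 1) (by omega)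
      (fun i _ _ => by rw [h, mul_zero, map_zero]) (n * G.natDegree - j) (by omega) (by omega)
    rwa [Nat.sub_sub_self hj.le] at this

theorem polySum_single {N i : ℕ} (hi : i < N) (a : L) :
    polySum σ n G N (Pi.single i a) = mon σ n G i a := by
  rw [polySum_apply, Finset.sum_eq_single i]
  · simp
  · intro j _ hj; simp [hj]
  · intro h; exact absurd (Finset.mem_range.2 hi) h

theorem mon_mem_range_polySum {N i : ℕ} (hi : i < N) (a : L) :
    mon σ n G i a ∈ (polySum σ n G N).range :=
  ⟨Pi.single i a, polySum_single hi a⟩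

theorem sum_mon_mul_coeff_eq_zero (i : ℕ) (a : L) :
    ∑ l ∈ Finset.range (G.natDegree + 1), mon σ n G (i + n * l) (a * algebraMap K L (G.coeff l))
        = 0 := by
  have h : mon σ n G i a * polyHom σ n G G = 0 := by rw [polyHom_self, mul_zero]
  rw [polyHom_apply, sum_over_range _ (by simp), Finset.mul_sum] at h
  rw [← h]
  refine Finset.sum_congr rfl fun l _ => ?_
  rw [mon_mul_mon, AlgEquiv.commutes]

theorem polySum_surjective (hn : 0 < n) (hG : G.Monic) (b : SkewQuot σ n G) :
    ∃ β, polySum σ n G (n * G.natDegree) β = b := by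
  change b ∈ (polySum σ n G (n * G.natDegree)).range
  induction b using quot_induction with
  | h0 => exact zero_mem _
  | hadd p q hp hq => exact add_mem hp hq
  | hmon i a =>
    induction i using Nat.strong_induction_on generalizing a with
    | _ i ih =>
      by_cases hi : i < n * G.natDegree
      · exact mon_mem_range_polySum hi a
      · have h := sum_mon_mul_coeff_eq_zero (σ := σ) (n := n) (G := G) (i - n * G.natDegree) a
        rw [Finset.sum_range_succ, hG.coeff_natDegree, map_one, mul_one,
          Nat.sub_add_cancel (not_lt.1 hi)] at h
        rw [eq_neg_of_add_eq_zero_right h]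
        refine neg_mem (sum_mem fun l hl => ih _ ?_ _)
        rw [Finset.mem_range] at hl
        have := (Nat.mul_lt_mul_left hn).2 hl
        omega

end SkewQuot

/-! ### Codes with boundary conditions and their orthogonals -/

namespace SkewQuot

variable {K L : Type*} [Field K] [Field L] [Algebra K L] (σ : L ≃ₐ[K] L) (n : ℕ) (G : K[X])

/-- The classes of the skew polynomials of degree at most `N` whose constant and top coefficients
`u` and `v` satisfy `Q u v`. -/
def polyCode (N : ℕ) (Q : L → L → Prop) : Set (SkewQuot σ n G) :=
  {b | ∃ a : ℕ → L, Q (a 0) (a N) ∧ b = polySum σ n G (N + 1) a}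

variable {σ n G}

theorem polySum_congr {N : ℕ} {a b : ℕ → L} (h : ∀ i < N, a i = b i) :
    polySum σ n G N a = polySum σ n G N b := by
  rw [polySum_apply, polySum_apply]
  exact Finset.sum_congr rfl fun i hi => by rw [h i (Finset.mem_range.1 hi)]

theorem polySum_eq_of_le {N N' : ℕ} (hN : N' ≤ N) {a : ℕ → L} (h : ∀ i < N, N' ≤ i → a i = 0) :
    polySum σ n G N a = polySum σ n G N' a := by
  rw [polySum_apply, polySum_apply]
  symm
  refine Finset.sum_subset (Finset.range_mono hN) fun i hi hi' => ?_
  rw [h i (Finset.mem_range.1 hi) (by simpa using hi'), map_zero]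

/-- The pairing of two skew polynomials of complementary degrees sees only their constant and top
coefficients. -/
theorem constCoeff_polySum_mul_polySum (hσ : σ ^ n = 1) (hn : 0 < n) (hG : G.Monic)
    (hGd : 0 < G.natDegree) {N N' : ℕ} (hN : N + N' = n * G.natDegree) (a b : ℕ → L) :
    constCoeff hσ hn hG (polySum σ n G (N + 1) a * polySum σ n G (N' + 1) b) =
      a 0 * b 0 - algebraMap K L (G.coeff 0) * a N * (σ ^ N) (b N') := by
  have hpos : 0 < n * G.natDegree := Nat.mul_pos hn hGd
  have h0 : ∀ i ∈ Finset.range (N + 1), ∀ j ∈ Finset.range (N' + 1),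
      (if n ∣ i + j then
        a i * (σ ^ i) (b j) * algebraMap K L (remCoeff G (X ^ ((i + j) / n))) else 0) =
      (if i = 0 then if j = 0 then a 0 * b 0 else 0 else 0) +
      (if i = N then if j = N' then
        -(algebraMap K L (G.coeff 0) * a N * (σ ^ N) (b N')) else 0 else 0) := by
    intro i hi j hj
    rw [Finset.mem_range] at hi hj
    by_cases hz : i = 0 ∧ j = 0
    · obtain ⟨rfl, rfl⟩ := hz
      have : ¬ (0 = N ∧ 0 = N') := by omega
      rw [← ite_and (0 = N), if_neg this]
      simp [show remCoeff G 1 = 1 by simpa using remCoeff_X_pow_of_lt hG hGd]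
    · rw [← ite_and (i = 0), if_neg hz]
      by_cases hz' : i = N ∧ j = N'
      · obtain ⟨rfl, rfl⟩ := hz'
        rw [hN, if_pos (dvd_mul_right _ _), Nat.mul_div_cancel_left _ hn,
          remCoeff_X_pow_natDegree hG hGd, map_neg]
        simp only [if_true]
        ring
      · rw [← ite_and (i = N), if_neg hz', add_zero]
        split_ifs with hd
        · rw [remCoeff_term hG (by omega) (by omega) hd, map_zero, mul_zero]
        · rfl
  rw [polySum_apply, Finset.sum_mul, map_sum]
  simp_rw [constCoeff_mon_mul_polySum]
  rw [Finset.sum_congr rfl fun i hi => Finset.sum_congr rfl (h0 i hi)]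
  simp [Finset.sum_add_distrib, sub_eq_add_neg]

/-- The orthogonal of a code of length `N` with respect to the trace form is a code of
complementary length. -/
theorem orthogonal_polyCode (hσ : σ ^ n = 1) (hn : 0 < n) (hG : G.Monic)
    (hG0 : G.coeff 0 ≠ 0) (hGd : 0 < G.natDegree) {N N' : ℕ} (hN : N + N' = n * G.natDegree)
    (hN0 : 0 < N) {P : Type*} [AddCommGroup P] (t : L →+ P)
    (ht : ∀ a, (∀ b, t (b * a) = 0) → a = 0) {Q : L → L → Prop} (hQ : Q 0 0) :
    {b | ∀ a ∈ polyCode σ n G N Q, t (constCoeff hσ hn hG (a * b)) = 0} =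
      polyCode σ n G N' (fun u v => ∀ a b, Q a b →
        t (a * u) = t (algebraMap K L (G.coeff 0) * b * (σ ^ N) v)) := by
  ext b
  constructor
  · intro hb
    obtain ⟨β, rfl⟩ := polySum_surjective (σ := σ) hn hG b
    have h1 := coeff_eq_zero_of_constCoeff hσ hn hG hG0 hGd β (N - 1)
      (by omega) (fun i hi1 hi2 => by
        refine ht _ fun a => ?_
        rw [← constCoeff_mon_zero_mul, ← mul_assoc, mon_mul_mon]
        refine hb _ ⟨Pi.single i a, ?_, ?_⟩
        · rwa [Pi.single_eq_of_ne (by omega), Pi.single_eq_of_ne (by omega)]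
        · rw [polySum_single (by omega)]; simp)
    have h2 : polySum σ n G (n * G.natDegree) β = polySum σ n G (N' + 1) β := by
      refine polySum_eq_of_le (by omega) fun i hi hi' => ?_
      have := h1 (n * G.natDegree - i) (by omega) (by omega)
      rwa [Nat.sub_sub_self hi.le] at this
    rw [h2] at hb ⊢
    refine ⟨β, fun u v huv => ?_, rfl⟩
    -- test against the binomials `u + v x ^ N` with `Q u v`
    have h3 := hb _ ⟨fun i => if i = 0 then u else if i = N then v else 0, by simpa [hN0.ne'], rfl⟩
    rw [constCoeff_polySum_mul_polySum hσ hn hG hGd hN, map_sub, sub_eq_zero] at h3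
    simpa [hN0.ne'] using h3
  · rintro ⟨β, hβ, rfl⟩ _ ⟨a, ha, rfl⟩
    rw [constCoeff_polySum_mul_polySum hσ hn hG hGd hN, map_sub, hβ _ _ ha, sub_self]

/-! ### The reciprocal polynomial and the inverse of `x` -/

/-- Elements of the form `P(x ^ n)` with `P ∈ K[y]` are central. -/
theorem polyHom_mul_comm (hσ : σ ^ n = 1) (P : K[X]) (b : SkewQuot σ n G) :
    polyHom σ n G P * b = b * polyHom σ n G P := by
  rw [polyHom_apply, Polynomial.sum, Finset.sum_mul, Finset.mul_sum]
  refine Finset.sum_congr rfl fun l _ => ?_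
  induction b using quot_induction with
  | h0 => simp
  | hadd p q hp hq => rw [mul_add, add_mul, hp, hq]
  | hmon i a =>
    rw [mon_mul_mon, mon_mul_mon, AlgEquiv.commutes, pow_mul_apply_eq hσ, mul_comm a, add_comm i]

theorem isUnit_polyHom (hσ : σ ^ n = 1) {P : K[X]} (h : IsCoprime P G) :
    IsUnit (polyHom σ n G P) := by
  obtain ⟨a, b, hab⟩ := h
  have h1 : polyHom σ n G a * polyHom σ n G P = 1 := by
    rw [← map_mul, ← map_one (polyHom σ n G), ← hab, map_add, map_mul _ b, polyHom_self, mul_zero,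
      add_zero]
  exact ⟨⟨_, _, by rwa [polyHom_mul_comm hσ], h1⟩, rfl⟩

theorem isCoprime_X (hG0 : G.coeff 0 ≠ 0) : IsCoprime X G := by
  refine (irreducible_X.coprime_iff_not_dvd).2 fun h => hG0 (X_dvd_iff.1 h)

theorem polyHom_X : polyHom σ n G X = mon σ n G n 1 := by
  have := polyHom_C_mul_X_pow σ n G 1 1
  simpa using this

theorem isUnit_mon_one (hσ : σ ^ n = 1) (hn : 0 < n) (hG0 : G.coeff 0 ≠ 0) :
    IsUnit (mon σ n G 1 1) := by
  have h : IsUnit (mon σ n G 1 1 ^ n) := by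
    rw [mon_pow, one_mul, ← polyHom_X]; exact isUnit_polyHom hσ (isCoprime_X hG0)
  exact (isUnit_pow_iff hn.ne').1 h

/-- If `y` is an element of a ring with `α y = y σ(α)` and `F(y ^ n) = 0`, then `x ↦ y` extends to
an anti-homomorphism on `R_F`. -/
theorem exists_antiHom {F : K[X]} {S : Type*} [Ring S] (f : L →+* S) (y : S)
    (hy : ∀ a, f a * y = y * f (σ a))
    (hF : ∑ l ∈ Finset.range (F.natDegree + 1), y ^ (n * l) * f (algebraMap K L (F.coeff l)) = 0) :
    ∃ φ : SkewQuot σ n F →+* Sᵐᵒᵖ, ∀ i a,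
      φ (mon σ n F i a) = MulOpposite.op (y ^ i * f a) := by
  have hy' : ∀ i a, f a * y ^ i = y ^ i * f ((σ ^ i) a) := by
    intro i
    induction i with
    | zero => simp
    | succ i ih =>
      intro a
      rw [pow_succ, ← mul_assoc, ih, mul_assoc, hy, mul_assoc, pow_succ', AlgEquiv.mul_apply]
  let f' : SkewCoeff σ →+* Sᵐᵒᵖ := f.toOpposite fun a b => by
    change f a * f b = f b * f a
    rw [← map_mul, mul_comm, map_mul]
  let ψ : SkewRing σ →+* Sᵐᵒᵖ := SkewMonoidAlgebra.liftNCRingHom f'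
    (powersHom Sᵐᵒᵖ (MulOpposite.op y)) (fun {a i} => by
      change MulOpposite.op (f ((σ ^ i.toAdd) a)) * MulOpposite.op y ^ i.toAdd =
        MulOpposite.op y ^ i.toAdd * MulOpposite.op (f a)
      rw [← MulOpposite.op_pow, ← MulOpposite.op_mul, ← MulOpposite.op_mul]
      exact congrArg _ (hy' i.toAdd a).symm)
  have hψ : ∀ i a, ψ (skewMonomial σ i a) = MulOpposite.op (y ^ i * f a) := by
    intro i a
    refine (SkewMonoidAlgebra.liftNC_single (k := SkewCoeff σ) _ _ _ _).trans ?_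
    change MulOpposite.op (f a) * MulOpposite.op y ^ i = _
    rw [← MulOpposite.op_pow, ← MulOpposite.op_mul]
  have hψF : ψ (evalXPow σ n F) = 0 := by
    rw [evalXPow, sum_over_range _ (by simp), map_sum]
    simp_rw [hψ]
    rw [← Finset.op_sum, hF, MulOpposite.op_zero]
  have hle : TwoSidedIdeal.span ({evalXPow σ n F} : Set (SkewRing σ)) ≤ TwoSidedIdeal.ker ψ := by
    rw [TwoSidedIdeal.span_le, Set.singleton_subset_iff]
    exact (TwoSidedIdeal.mem_ker ψ).2 hψF
  refine ⟨RingCon.lift _ ψ ?_, fun i a => hψ i a⟩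
  exact TwoSidedIdeal.ringCon_le_iff.1 hle


theorem monicReciprocal_coeff {F : K[X]} {l : ℕ} (hl : l ≤ F.natDegree) :
    (monicReciprocal F).coeff l = (F.coeff 0)⁻¹ * F.coeff (F.natDegree - l) := by
  rw [monicReciprocal, coeff_C_mul, coeff_reverse, revAt_le hl]

theorem monicReciprocal_natDegree {F : K[X]} (h0 : F.coeff 0 ≠ 0) :
    (monicReciprocal F).natDegree = F.natDegree := by
  have : F.natTrailingDegree = 0 :=
    natTrailingDegree_eq_zero_of_constantCoeff_ne_zero h0
  rw [monicReciprocal, natDegree_C_mul (inv_ne_zero h0), reverse_natDegree, this, Nat.sub_zero]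

theorem monicReciprocal_monic {F : K[X]} (h0 : F.coeff 0 ≠ 0) : (monicReciprocal F).Monic := by
  rw [Monic, leadingCoeff, monicReciprocal_natDegree h0, monicReciprocal_coeff le_rfl, Nat.sub_self,
    inv_mul_cancel₀ h0]

theorem monicReciprocal_coeff_zero {F : K[X]} (hF : F.Monic) :
    (monicReciprocal F).coeff 0 = (F.coeff 0)⁻¹ := by
  rw [monicReciprocal_coeff (Nat.zero_le _), Nat.sub_zero, hF.coeff_natDegree, mul_one]

theorem inv_pow_mul_mon {y : SkewQuot σ n G} (hy : y * mon σ n G 1 1 = 1) (i j : ℕ) (a : L) :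
    y ^ i * mon σ n G (i + j) a = mon σ n G j ((σ ^ i).symm a) := by
  have h1 : y ^ i * mon σ n G i 1 = 1 := by
    induction i with
    | zero => simp
    | succ i ih =>
      have : mon σ n G (i + 1) 1 = mon σ n G 1 1 * mon σ n G i 1 := by
        rw [mon_mul_mon]; simp [add_comm]
      rw [this, pow_succ, mul_assoc, ← mul_assoc y, hy, one_mul, ih]
  have h2 : mon σ n G (i + j) a = mon σ n G i 1 * mon σ n G j ((σ ^ i).symm a) := by
    rw [mon_mul_mon]; simp
  rw [h2, ← mul_assoc, h1, one_mul]

/-- The anti-homomorphism `a x ^ i ↦ x ^ (-i) a` from `R_F` to the quotient ring of the reciprocal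
polynomial. -/
theorem exists_antiHom_reciprocal (hσ : σ ^ n = 1) (hn : 0 < n) {F : K[X]} (h0 : F.coeff 0 ≠ 0)
    (hF : F.Monic) :
    ∃ (y : SkewQuot σ n (monicReciprocal F))
      (φ : SkewQuot σ n F →+* (SkewQuot σ n (monicReciprocal F))ᵐᵒᵖ),
      y * mon σ n (monicReciprocal F) 1 1 = 1 ∧ ∀ i a,
      φ (mon σ n F i a) = MulOpposite.op (y ^ i * mon σ n (monicReciprocal F) 0 a) := by
  have hF0 : (monicReciprocal F).coeff 0 ≠ 0 := by
    rw [monicReciprocal_coeff_zero hF]; exact inv_ne_zero h0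
  set G := monicReciprocal F with hG
  obtain ⟨u, hu⟩ := isUnit_mon_one hσ hn hF0
  have hy1 : (↑u⁻¹ : SkewQuot σ n G) * mon σ n G 1 1 = 1 := by rw [← hu, Units.inv_mul]
  have hy2 : mon σ n G 1 1 * (↑u⁻¹ : SkewQuot σ n G) = 1 := by rw [← hu, Units.mul_inv]
  let f : L →+* SkewQuot σ n G :=
    { toFun := mon σ n G 0
      map_zero' := by simp
      map_one' := by simp
      map_add' a b := by simp
      map_mul' a b := by simp [mon_mul_mon] }
  have hf : ∀ a, f a = mon σ n G 0 a := fun _ => rfl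
  obtain ⟨φ, hφ⟩ := exists_antiHom (σ := σ) (n := n) (F := F) f (↑u⁻¹ : SkewQuot σ n G) (fun a => by
      rw [hf, hf]
      have h1 : mon σ n G 1 1 * mon σ n G 0 a = mon σ n G 0 (σ a) * mon σ n G 1 1 := by
        rw [mon_mul_mon, mon_mul_mon]; simp
      calc mon σ n G 0 a * (↑u⁻¹ : SkewQuot σ n G)
          = ↑u⁻¹ * (mon σ n G 1 1 * mon σ n G 0 a) * ↑u⁻¹ := by rw [← mul_assoc, hy1, one_mul]
        _ = _ := by rw [h1, mul_assoc, mul_assoc, hy2, mul_one]) (by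
      have h := sum_mon_mul_coeff_eq_zero (σ := σ) (n := n) (G := G) 0 (algebraMap K L (F.coeff 0))
      rw [monicReciprocal_natDegree h0] at h
      -- multiply `G(x ^ n) = 0` by `x ^ (-n s)`: the coefficients of `G` are those of `F` reversed
      have h' := congrArg ((↑u⁻¹ : SkewQuot σ n G) ^ (n * F.natDegree) * ·) h
      simp only [mul_zero, Finset.mul_sum] at h'
      rw [← h', ← Finset.sum_range_reflect]
      refine Finset.sum_congr rfl fun l hl => ?_
      have hl' : l ≤ F.natDegree := by simpa [Nat.lt_succ_iff] using hl
      rw [show F.natDegree + 1 - 1 - l = F.natDegree - l by omega, hf, monicReciprocal_coeff hl',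
        map_mul (algebraMap K L), ← mul_assoc, ← map_mul, mul_inv_cancel₀ h0, map_one, one_mul,
            zero_add]
      have h2 : n * F.natDegree = n * (F.natDegree - l) + n * l := by
        rw [← mul_add, Nat.sub_add_cancel hl']
      have h3 := inv_pow_mul_mon hy1 (n * l) 0 (algebraMap K L (F.coeff (F.natDegree - l)))
      rw [add_zero] at h3
      rw [h2, pow_add, mul_assoc, h3, (AlgEquiv.symm_apply_eq _).2 (AlgEquiv.commutes _ _).symm])
  exact ⟨_, φ, hy1, fun i a => hφ i a⟩

theorem antiHom_polySum_mul {F : K[X]} {y : SkewQuot σ n G}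
    {φ : SkewQuot σ n F →+* (SkewQuot σ n G)ᵐᵒᵖ} (hy : y * mon σ n G 1 1 = 1)
    (hφ : ∀ i a, φ (mon σ n F i a) = MulOpposite.op (y ^ i * mon σ n G 0 a)) (N : ℕ) (b : ℕ → L) :
    (φ (polySum σ n F (N + 1) b)).unop * mon σ n G N 1 =
      polySum σ n G (N + 1) (fun i => (σ ^ (N - i)).symm (b (N - i))) := by
  rw [polySum_apply, polySum_apply, map_sum, Finset.unop_sum, Finset.sum_mul,
    ← Finset.sum_range_reflect]
  refine Finset.sum_congr rfl fun i hi => ?_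
  have hi' : i ≤ N := by simpa [Nat.lt_succ_iff] using hi
  rw [show N + 1 - 1 - i = N - i by omega, hφ, MulOpposite.unop_op, mul_assoc, mon_mul_mon,
    ← inv_pow_mul_mon hy (N - i) i]
  simp [Nat.sub_add_cancel hi']

/-- The substitution `x ↦ x⁻¹`, followed by multiplication with `x ^ N`, reverses the coefficients
of the codes. -/
theorem antiHom_polyCode {F : K[X]} {y : SkewQuot σ n G}
    {φ : SkewQuot σ n F →+* (SkewQuot σ n G)ᵐᵒᵖ} (hy : y * mon σ n G 1 1 = 1)
    (hφ : ∀ i a, φ (mon σ n F i a) = MulOpposite.op (y ^ i * mon σ n G 0 a)) (N : ℕ)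
    (Q : L → L → Prop) :
    (fun b => (φ b).unop * mon σ n G N 1) '' polyCode σ n F N Q =
      polyCode σ n G N (fun u v => Q v ((σ ^ N) u)) := by
  ext c
  constructor
  · rintro ⟨_, ⟨b, hb, rfl⟩, rfl⟩
    refine ⟨_, ?_, antiHom_polySum_mul hy hφ N b⟩
    have h1 : (1 : L ≃ₐ[K] L).symm (b 0) = b 0 := rfl
    simpa [h1] using hb
  · rintro ⟨a, ha, rfl⟩
    refine ⟨_, ⟨fun j => (σ ^ j) (a (N - j)), by simpa using ha, rfl⟩, ?_⟩
    refine (antiHom_polySum_mul hy hφ N _).trans (polySum_congr fun i hi => ?_)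
    rw [AlgEquiv.symm_apply_apply, Nat.sub_sub_self (by omega)]

end SkewQuot

/-! ### Ring automorphisms and traces of full matrix rings -/

namespace MatrixCode

open Matrix

/-- Every ring automorphism of `M_n(E)` is the composition of an automorphism of `E`, applied to all
entries, and an inner automorphism. -/
theorem exists_conj_map {E : Type*} [Field E] {n : ℕ} (hn : 0 < n)
    (Ψ : Matrix (Fin n) (Fin n) E ≃+* Matrix (Fin n) (Fin n) E) :
    ∃ (P : (Matrix (Fin n) (Fin n) E)ˣ) (τ : E ≃+* E), ∀ A,
      Ψ A = P * A.map τ * (↑P⁻¹ : Matrix (Fin n) (Fin n) E) := by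
  have : Nonempty (Fin n) := ⟨⟨0, hn⟩⟩
  -- the automorphism restricts to the center, which consists of the scalar matrices
  have key : ∀ Φ : Matrix (Fin n) (Fin n) E ≃+* Matrix (Fin n) (Fin n) E, ∀ c : E,
      ∃ d, scalar (Fin n) d = Φ (scalar (Fin n) c) := by
    intro Φ c
    have h : Φ (scalar (Fin n) c) ∈ Set.center (Matrix (Fin n) (Fin n) E) := by
      rw [Semigroup.mem_center_iff]
      intro B
      obtain ⟨B, rfl⟩ := Φ.surjective B
      rw [← map_mul, ← map_mul, (scalar_commute c (fun r => mul_comm c r) B).eq]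
    rw [center_eq_range] at h
    exact h
  have hinj : Function.Injective (scalar (Fin n) : E → Matrix (Fin n) (Fin n) E) :=
    fun _ _ h => scalar_inj.1 h
  choose f hf using key Ψ
  choose g hg using key Ψ.symm
  let τ : E ≃+* E :=
    { toFun := f
      invFun := g
      left_inv c := hinj (by rw [hg, hf, Ψ.symm_apply_apply])
      right_inv c := hinj (by rw [hf, hg, Ψ.apply_symm_apply])
      map_mul' a b := hinj (by rw [hf, map_mul, map_mul, map_mul, hf, hf])
      map_add' a b := hinj (by rw [hf, map_add, map_add, map_add, hf, hf]) }
  have hτ : ∀ c, scalar (Fin n) (τ c) = Ψ (scalar (Fin n) c) := hf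
  -- composing with the inverse of `τ` on entries gives an `E`-algebra automorphism, which is inner
  let Θ : Matrix (Fin n) (Fin n) E ≃ₐ[E] Matrix (Fin n) (Fin n) E :=
    AlgEquiv.ofRingEquiv (f := (τ.symm.mapMatrix (m := Fin n)).trans Ψ) (fun c => by
      rw [RingEquiv.trans_apply]
      have h1 : (τ.symm.mapMatrix (m := Fin n)) (algebraMap E _ c) = scalar (Fin n) (τ.symm c) := by
        rw [RingEquiv.mapMatrix_apply]
        ext i j
        simp [algebraMap_matrix_apply, scalar_apply, diagonal_apply, apply_ite τ.symm]
      rw [h1, ← hτ, RingEquiv.apply_symm_apply]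
      rfl)
  have hΘ : ∀ A, Ψ A = Θ (A.map τ) := by
    intro A
    change Ψ A = Ψ ((A.map τ).map τ.symm)
    congr 1
    ext i j
    simp
  obtain ⟨T, hT⟩ := AlgEquiv.eq_linearEquivConjAlgEquiv
    ((toLinAlgEquiv'.symm.trans Θ).trans toLinAlgEquiv')
  refine ⟨⟨LinearMap.toMatrix' T.toLinearMap, LinearMap.toMatrix' T.symm.toLinearMap, ?_, ?_⟩, τ,
    fun A => ?_⟩
  · rw [← LinearMap.toMatrix'_comp, LinearEquiv.comp_coe, LinearEquiv.symm_trans_self]; simp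
  · rw [← LinearMap.toMatrix'_comp, LinearEquiv.comp_coe, LinearEquiv.self_trans_symm]; simp
  · rw [hΘ]
    have h2 := congrArg LinearMap.toMatrix' (AlgEquiv.congr_fun hT (toLin' (A.map τ)))
    have h3 : toLinAlgEquiv' (R := E).symm (toLin' (A.map τ)) = A.map τ :=
      LinearMap.toMatrix'_toLin' _
    rw [AlgEquiv.trans_apply, AlgEquiv.trans_apply, h3, LinearEquiv.conjAlgEquiv_apply,
      LinearMap.toMatrix'_comp, LinearMap.toMatrix'_comp, LinearMap.toMatrix'_toLin'] at h2
    rw [mul_assoc]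
    refine Eq.trans ?_ h2
    exact (LinearMap.toMatrix'_toLin' _).symm

/-- An additive map on `M_n(E)` that does not distinguish `X * Y` from `Y * X` factors through the
matrix trace. -/
theorem exists_eq_trace {E P : Type*} [Field E] [AddCommGroup P] {n : ℕ} (hn : 0 < n)
    (T : Matrix (Fin n) (Fin n) E →+ P) (hT : ∀ X Y, T (X * Y) = T (Y * X)) :
    ∃ f : E →+ P, ∀ X, T X = f X.trace := by
  have hoff : ∀ i j c, i ≠ j → T (single i j c) = 0 := by
    intro i j c hij
    have h1 : single i j c = single i i 1 * single i j c := by simp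
    rw [h1, hT, single_mul_single_of_ne c i j i hij.symm, map_zero]
  have hdiag : ∀ i j c, T (single i i c) = T (single j j c) := by
    intro i j c
    have h1 : single i i c = single i j c * single j i 1 := by simp
    rw [h1, hT]; simp
  let i0 : Fin n := ⟨0, hn⟩
  refine ⟨T.comp (singleAddMonoidHom i0 i0), fun X => ?_⟩
  conv_lhs => rw [matrix_eq_sum_single X]
  rw [trace, map_sum, map_sum]
  refine Finset.sum_congr rfl fun i _ => ?_
  rw [map_sum, Finset.sum_eq_single i]
  · exact hdiag i i0 _
  · intro j _ hj; exact hoff i j _ hj.symm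
  · simp

theorem exists_eq_trace_mul {E : Type*} [Field E] [Finite E] {p : ℕ} [Fact p.Prime]
    [Algebra (ZMod p) E] (f : E →+ ZMod p) :
    ∃ z, ∀ x, f x = Algebra.trace (ZMod p) E (z * x) := by
  have hnd := traceForm_nondegenerate (ZMod p) E
  refine ⟨((Algebra.traceForm (ZMod p) E).toDual hnd).symm (f.toZModLinearMap p), fun x => ?_⟩
  rw [← Algebra.traceForm_apply, ← LinearMap.BilinForm.toDual_def hnd, LinearEquiv.apply_symm_apply]
  rfl

theorem trace_bot_eq_zero_iff {E : Type*} [Field E] {p : ℕ} [Fact p.Prime]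
    [Algebra (ZMod p) E] (x : E) :
    Algebra.trace (⊥ : Subfield E) E x = 0 ↔ Algebra.trace (ZMod p) E x = 0 := by
  have hle : (⊥ : Subfield E) ≤ (algebraMap (ZMod p) E).fieldRange := bot_le
  let g : ZMod p →+* (⊥ : Subfield E) := (algebraMap (ZMod p) E).codRestrict _ (fun a => by
    have : algebraMap (ZMod p) E a = ((a.val : ℕ) : E) := by
      rw [← map_natCast (algebraMap (ZMod p) E), ZMod.natCast_zmod_val]
    rw [this]; exact natCast_mem _ _)
  let e : ZMod p ≃+* (⊥ : Subfield E) := RingEquiv.ofBijective g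
    ⟨g.injective, fun ⟨y, hy⟩ => by
      obtain ⟨a, ha⟩ := hle hy
      exact ⟨a, Subtype.ext ha⟩⟩
  rw [← Algebra.trace_eq_of_ringEquiv e (RingHom.ext fun _ => rfl), map_eq_zero_iff e e.injective]

/-- Let `A ≅ M_n(E)` carry a nonzero trace functional `T`, and let `φ` be an anti-homomorphism from
`A` to a ring `A' ≅ M_n(E)`. The dual of a code in `A` is, up to equivalence, the image under `φ` of
its orthogonal with respect to `T`: the functional is `Tr(z tr X)` for some `z ∈ E`, and `φ` is the
transposition followed by a semilinear automorphism. -/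
theorem codeEquivalent_dualCode {E A A' : Type*} [Field E] [Finite E] [Ring A] [Ring A'] {n : ℕ}
    (hn : 0 < n) {p : ℕ} [Fact p.Prime] [Algebra (ZMod p) E]
    (m : A ≃+* Matrix (Fin n) (Fin n) E) (m' : A' ≃+* Matrix (Fin n) (Fin n) E)
    (φ : A →+* A'ᵐᵒᵖ) (T : A →+ ZMod p) (hT : ∀ a b, T (a * b) = T (b * a)) (hT0 : ∃ a, T a ≠ 0)
    (C : Set A) :
    CodeEquivalent (dualCode (m '' C))
      (m' '' ((fun b => (φ b).unop) '' {b | ∀ a ∈ C, T (a * b) = 0})) := by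
  have : Nonempty (Fin n) := ⟨⟨0, hn⟩⟩
  obtain ⟨f, hf⟩ := exists_eq_trace hn (T.comp m.symm.toRingHom.toAddMonoidHom)
    (fun X Y => by
      change T (m.symm (X * Y)) = T (m.symm (Y * X))
      rw [map_mul m.symm, map_mul m.symm, hT])
  obtain ⟨z, hz⟩ := exists_eq_trace_mul f
  have hTz : ∀ a, T a = Algebra.trace (ZMod p) E (z * (m a).trace) := by
    intro a
    rw [← hz, ← hf]
    exact congrArg T (m.symm_apply_apply a).symm
  have hz0 : z ≠ 0 := by
    rintro rfl
    obtain ⟨a, ha⟩ := hT0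
    exact ha (by rw [hTz, zero_mul, map_zero])
  let ψ : Matrix (Fin n) (Fin n) E →+* Matrix (Fin n) (Fin n) E :=
    ((((transposeRingEquiv (Fin n) E).symm.toRingHom).comp (RingEquiv.op m').toRingHom).comp φ).comp
      m.symm.toRingHom
  have hψ : ∀ X, ψ X = (m' (φ (m.symm X)).unop)ᵀ := fun _ => rfl
  obtain ⟨P, τ, hP⟩ := exists_conj_map hn (RingEquiv.ofBijective ψ
    (Finite.injective_iff_bijective.1 ψ.injective))
  have hP' : ∀ b, m' (φ b).unop = ((P : Matrix (Fin n) (Fin n) E) * (m b).map τ * (↑P⁻¹ : Matrix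
      (Fin n) (Fin n) E))ᵀ := by
    intro b
    rw [← hP]
    change _ = (ψ _)ᵀ
    rw [hψ, transpose_transpose, m.symm_apply_apply]
  have hτz : τ z ≠ 0 := by simpa using hz0
  refine ⟨⟨(τ z)⁻¹ • (↑P⁻¹ : Matrix (Fin n) (Fin n) E)ᵀ, τ z • (P : Matrix (Fin n) (Fin n) E)ᵀ,
      ?_, ?_⟩,
    ⟨(P : Matrix (Fin n) (Fin n) E)ᵀ, (↑P⁻¹ : Matrix (Fin n) (Fin n) E)ᵀ, ?_, ?_⟩, τ, ?_⟩
  · rw [smul_mul_smul_comm, inv_mul_cancel₀ hτz, one_smul, ← transpose_mul, P.mul_inv,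
      transpose_one]
  · rw [smul_mul_smul_comm, mul_inv_cancel₀ hτz, one_smul, ← transpose_mul, P.inv_mul,
      transpose_one]
  · rw [← transpose_mul, P.inv_mul, transpose_one]
  · rw [← transpose_mul, P.mul_inv, transpose_one]
  -- `Y` lies in the dual iff the element of `A` corresponding to `z⁻¹ Yᵀ` is orthogonal to the code
  have hdual : ∀ b, (∀ a ∈ C, T (a * b) = 0) ↔ (z • m b)ᵀ ∈ dualCode (m '' C) := by
    intro b
    simp only [dualCode, Set.mem_ofPred_eq, Set.forall_mem_image]
    refine forall₂_congr fun a _ => ?_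
    rw [trace_bot_eq_zero_iff (p := p), transpose_transpose, mul_smul_comm, trace_smul, smul_eq_mul,
      hTz, map_mul m]
  have himg : ∀ b, m' (φ b).unop = (τ z)⁻¹ • (↑P⁻¹ : Matrix (Fin n) (Fin n) E)ᵀ *
      ((z • m b)ᵀ).map τ * (P : Matrix (Fin n) (Fin n) E)ᵀ := by
    intro b
    have h1 : ((z • m b)ᵀ).map τ = τ z • ((m b).map τ)ᵀ := by ext i j; simp
    rw [hP', h1, smul_mul_smul_comm, inv_mul_cancel₀ hτz, one_smul, transpose_mul, transpose_mul,
      mul_assoc]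
  ext Z
  constructor
  · rintro ⟨_, ⟨b, hb, rfl⟩, rfl⟩
    exact ⟨_, (hdual b).1 hb, (himg b).symm⟩
  · rintro ⟨Y, hY, rfl⟩
    have hb : (z • m (m.symm (z⁻¹ • Yᵀ)))ᵀ = Y := by
      rw [m.apply_symm_apply, smul_inv_smul₀ hz0, transpose_transpose]
    refine ⟨_, ⟨m.symm (z⁻¹ • Yᵀ), (hdual _).2 (by rwa [hb]), rfl⟩, ?_⟩
    rw [himg, hb]

/-- Multiplying a code by units of the ring on both sides does not change its equivalence class. -/
theorem codeEquivalent_mul_units {E A : Type*} [Field E] [Ring A] {n : ℕ}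
    (m : A ≃+* Matrix (Fin n) (Fin n) E) (u v : Aˣ) {D : Set (Matrix (Fin n) (Fin n) E)}
    {C C' : Set A}
    (h : CodeEquivalent D (m '' C)) (hC : C' = (fun b => (u : A) * b * (v : A)) '' C) :
    CodeEquivalent D (m '' C') := by
  obtain ⟨U, V, τ, h⟩ := h
  refine ⟨Units.map m.toMonoidHom u * U, V * Units.map m.toMonoidHom v, τ, ?_⟩
  rw [hC, Set.image_image]
  have : (fun b => m ((u : A) * b * (v : A))) = (fun X => m u * X * m v) ∘ m := by ext1 b; simp
  rw [this, Set.image_comp, h, Set.image_image]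
  refine Set.image_congr fun X _ => ?_
  simp [mul_assoc]

end MatrixCode

/-! ### The quotient rings are matrix rings -/

namespace SkewQuot

variable {K L : Type*} [Field K] [Field L] [Algebra K L] {σ : L ≃ₐ[K] L} {n : ℕ} {G : K[X]}

theorem exists_pow_fixed_imp [Finite L] (σ : L ≃ₐ[K] L) :
    ∃ α : L, ∀ i, (σ ^ i) α = α → σ ^ i = 1 := by
  obtain ⟨g, hg⟩ := IsCyclic.exists_generator (α := Lˣ)
  refine ⟨g, fun i hi => AlgEquiv.ext fun x => ?_⟩
  rcases eq_or_ne x 0 with rfl | hx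
  · simp
  · obtain ⟨l, hl⟩ := hg (Units.mk0 x hx)
    have : x = (g : L) ^ l := by
      rw [← Units.val_zpow_eq_zpow_val]; exact (congrArg Units.val hl).symm
    rw [this, map_zpow₀, hi, AlgEquiv.one_apply]

theorem orderOf_eq_finrank [Finite L] [FiniteDimensional K L] (hn : Module.finrank K L = n)
    (hσ : ∀ τ : L ≃ₐ[K] L, τ ∈ Subgroup.zpowers σ) : orderOf σ = n := by
  have : Finite K := Finite.of_injective _ (algebraMap K L).injective
  rw [← hn, ← IsGalois.card_aut_eq_finrank, orderOf_eq_card_of_forall_mem_zpowers hσ]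

theorem mon_mul_polySum_zero (N : ℕ) (c : L) (a : ℕ → L) :
    mon σ n G 0 c * polySum σ n G N a = polySum σ n G N (fun j => c * a j) := by
  rw [polySum_apply, polySum_apply, Finset.mul_sum]
  refine Finset.sum_congr rfl fun j _ => ?_
  rw [mon_mul_mon]; simp

theorem polySum_mul_mon_zero (N : ℕ) (c : L) (a : ℕ → L) :
    polySum σ n G N a * mon σ n G 0 c = polySum σ n G N (fun j => (σ ^ j) c * a j) := by
  rw [polySum_apply, polySum_apply, Finset.sum_mul]
  refine Finset.sum_congr rfl fun j _ => ?_
  rw [mon_mul_mon, mul_comm]; simp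

theorem mon_one_mul_polySum (N : ℕ) (a : ℕ → L) :
    mon σ n G 1 1 * polySum σ n G N a = polySum σ n G N (fun j => σ (a j)) * mon σ n G 1 1 := by
  rw [polySum_apply, polySum_apply, Finset.mul_sum, Finset.sum_mul]
  refine Finset.sum_congr rfl fun j _ => ?_
  rw [mon_mul_mon, mon_mul_mon, add_comm]; simp

theorem polySum_eq_sum_of_dvd (hn : 0 < n) (d : ℕ) (a : ℕ → L)
    (ha : ∀ j < n * d, ¬ n ∣ j → a j = 0) :
    polySum σ n G (n * d) a = ∑ l ∈ Finset.range d, mon σ n G (n * l) (a (n * l)) := by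
  rw [polySum_apply]
  have hinj : Set.InjOn (fun l => n * l) (Finset.range d : Set ℕ) :=
    fun x _ y _ h => Nat.eq_of_mul_eq_mul_left hn h
  rw [← Finset.sum_image (f := fun j => mon σ n G j (a j)) hinj]
  symm
  refine Finset.sum_subset ?_ fun j hj hj' => ?_
  · intro j hj
    obtain ⟨l, hl, rfl⟩ := Finset.mem_image.1 hj
    exact Finset.mem_range.2 ((Nat.mul_lt_mul_left hn).2 (Finset.mem_range.1 hl))
  · rw [Finset.mem_range] at hj
    rw [ha j hj, map_zero]
    rintro ⟨l, rfl⟩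
    exact hj' (Finset.mem_image.2 ⟨l, Finset.mem_range.2 (Nat.lt_of_mul_lt_mul_left hj), rfl⟩)

/-- A class whose representative is a polynomial in `x ^ n` with coefficients in `K` is the value of
a polynomial over `K`. -/
theorem polySum_eq_polyHom (hn : 0 < n) (d : ℕ) (a : ℕ → K) (ha : ∀ j < n * d, ¬ n ∣ j → a j = 0) :
    polySum σ n G (n * d) (fun j => algebraMap K L (a j)) =
      polyHom σ n G (∑ l ∈ Finset.range d, C (a (n * l)) * X ^ l) := by
  rw [polySum_eq_sum_of_dvd hn d _ (fun j hj hd => by rw [ha j hj hd, map_zero]), map_sum]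
  simp_rw [polyHom_C_mul_X_pow]

theorem exists_constCoeff_ne_zero (hσ : σ ^ n = 1) (hn : 0 < n) (hG : G.Monic)
    (hG0 : G.coeff 0 ≠ 0) (hGd : 0 < G.natDegree) {b : SkewQuot σ n G} (hb : b ≠ 0) :
    ∃ i, constCoeff hσ hn hG (mon σ n G i 1 * b) ≠ 0 := by
  by_contra! h
  obtain ⟨β, rfl⟩ := polySum_surjective (σ := σ) hn hG b
  have h1 := coeff_eq_zero_of_constCoeff hσ hn hG hG0 hGd β (n * G.natDegree - 1)
    (by have := Nat.mul_pos hn hGd; omega) (fun i _ _ => h i)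
  have h2 : ∀ j < n * G.natDegree, 1 ≤ j → β j = 0 := fun j hj hj1 => by
    have := h1 (n * G.natDegree - j) (by omega) (by omega)
    rwa [Nat.sub_sub_self hj.le] at this
  have h3 := h 0
  rw [polySum_eq_of_le (N' := 1) (by have := Nat.mul_pos hn hGd; omega) h2] at h3 hb
  rw [constCoeff_mon_mul_polySum] at h3
  have h4 : β 0 = 0 := by
    have h5 := remCoeff_X_pow_of_lt hG hGd
    simpa [h5, show remCoeff G 1 = 1 by simpa using h5] using h3
  exact hb (by rw [polySum_apply]; simp [h4])

theorem constCoeff_polySum (hσ : σ ^ n = 1) (hn : 0 < n) (hG : G.Monic)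
    (hGd : 0 < G.natDegree) (b : ℕ → L) :
    constCoeff hσ hn hG (polySum σ n G (n * G.natDegree) b) = b 0 := by
  have h := constCoeff_polySum_mul_polySum (σ := σ) hσ hn hG hGd (N := 0) (N' := n * G.natDegree)
    (zero_add _) (Pi.single 0 1) (fun j => if j < n * G.natDegree then b j else 0)
  rw [polySum_single (by omega), mon_zero_one, one_mul, polySum_eq_of_le (Nat.le_succ _)] at h
  · rw [polySum_congr (b := b) (fun i hi => by simp [hi])] at h
    rw [h]
    simp [Nat.mul_pos hn hGd]
  · intro i _ hi; simp [hi]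

theorem nontrivial_quot (hσ : σ ^ n = 1) (hn : 0 < n) (hG : G.Monic)
    (hGd : 0 < G.natDegree) : Nontrivial (SkewQuot σ n G) := by
  refine ⟨1, 0, fun h => ?_⟩
  have h1 := constCoeff_mon hσ hn hG 0 1
  rw [mon_zero_one, h, map_zero] at h1
  have h5 := remCoeff_X_pow_of_lt hG hGd
  simp [show remCoeff G 1 = 1 by simpa using h5] at h1

/-- `R_G` is in bijection with the skew polynomials of degree less than `n * deg G`. -/
theorem card_quot (hσ : σ ^ n = 1) (hn : 0 < n) (hG : G.Monic)
    (hG0 : G.coeff 0 ≠ 0) (hGd : 0 < G.natDegree) :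
    Nat.card (SkewQuot σ n G) = Nat.card L ^ (n * G.natDegree) := by
  let e : (Fin (n * G.natDegree) → L) → SkewQuot σ n G := fun a =>
    polySum σ n G (n * G.natDegree) (fun j => if h : j < n * G.natDegree then a ⟨j, h⟩ else 0)
  have he : Function.Bijective e := by
    constructor
    · intro a b hab
      have h1 := polySum_eq_zero hσ hn hG hG0 hGd _ ((map_sub _ _ _).trans (sub_eq_zero.2 hab))
      ext j
      have := h1 j j.2
      simpa [sub_eq_zero] using this
    · intro c
      obtain ⟨β, rfl⟩ := polySum_surjective (σ := σ) hn hG c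
      exact ⟨fun j => β j, polySum_congr fun i hi => by simp [hi]⟩
  rw [← Nat.card_congr (Equiv.ofBijective e he), Nat.card_fun, Nat.card_fin]

theorem finite_quot [Finite L] (hσ : σ ^ n = 1) (hn : 0 < n) (hG : G.Monic)
    (hG0 : G.coeff 0 ≠ 0) (hGd : 0 < G.natDegree) : Finite (SkewQuot σ n G) := by
  refine Nat.finite_of_card_ne_zero ?_
  rw [card_quot hσ hn hG hG0 hGd]
  exact pow_ne_zero _ Nat.card_pos.ne'

section Galois

variable [Finite L] [FiniteDimensional K L]

/-- A nonzero two-sided ideal of `R_G`, for `G` irreducible, contains `1`: conjugating with `L`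
isolates the part of an element that is a polynomial in `x ^ n`, averaging over the Galois group
makes its coefficients lie in `K`, and the nonzero elements of `K[y] / (G)` are units. -/
theorem one_mem_of_mem (hord : orderOf σ = n) (hσ : ∀ τ : L ≃ₐ[K] L, τ ∈ Subgroup.zpowers σ)
    (hn : 0 < n) (hG : G.Monic) (hirr : Irreducible G)
    (hG0 : G.coeff 0 ≠ 0) (I : TwoSidedIdeal (SkewQuot σ n G)) {b : SkewQuot σ n G}
    (hb : b ≠ 0) (hbI : b ∈ I) : (1 : SkewQuot σ n G) ∈ I := by
  have hσn : σ ^ n = 1 := hord ▸ pow_orderOf_eq_one σ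
  have hGd : 0 < G.natDegree := hirr.natDegree_pos
  have hpos : 0 < n * G.natDegree := Nat.mul_pos hn hGd
  -- after multiplication by a power of `x`, the constant coefficient is nonzero
  obtain ⟨i, hi⟩ := exists_constCoeff_ne_zero hσn hn hG hG0 hGd hb
  obtain ⟨γ, hγ⟩ := polySum_surjective (σ := σ) hn hG (mon σ n G i 1 * b)
  rw [← hγ, constCoeff_polySum hσn hn hG hGd] at hi
  have hγI : polySum σ n G (n * G.natDegree) γ ∈ I := hγ ▸ I.mul_mem_left _ _ hbI
  obtain ⟨α, hα⟩ := exists_pow_fixed_imp σ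
  -- the map `c ↦ σ ^ i (α) c - c α` multiplies the coefficient of `x ^ j` by `σ ^ i (α) - σ ^ j
  -- (α)`
  have hproj : ∀ S : Finset ℕ, polySum σ n G (n * G.natDegree)
      (fun j => (∏ i ∈ S, ((σ ^ i) α - (σ ^ j) α)) * γ j) ∈ I := by
    intro S
    induction S using Finset.induction_on with
    | empty => simpa using hγI
    | insert i S hiS ih =>
      have h1 := I.sub_mem (I.mul_mem_left (mon σ n G 0 ((σ ^ i) α)) _ ih)
        (I.mul_mem_right _ (mon σ n G 0 α) ih)
      rw [mon_mul_polySum_zero, polySum_mul_mon_zero, ← map_sub] at h1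
      convert h1 using 2
      ext j
      rw [Finset.prod_insert hiS, Pi.sub_apply]
      ring
  have hprojn := hproj (Finset.Ico 1 n)
  set δ : ℕ → L := fun j => (∏ i ∈ Finset.Ico 1 n, ((σ ^ i) α - (σ ^ j) α)) * γ j with hδ
  have hδ0 : δ 0 ≠ 0 := by
    refine mul_ne_zero (Finset.prod_ne_zero_iff.2 fun i hi h => ?_) hi
    rw [Finset.mem_Ico] at hi
    rw [pow_zero, AlgEquiv.one_apply, sub_eq_zero] at h
    have := orderOf_dvd_of_pow_eq_one (hα i h)
    rw [hord] at this
    exact absurd (Nat.le_of_dvd (by omega) this) (by omega)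
  have hδn : ∀ j, ¬ n ∣ j → δ j = 0 := by
    intro j hj
    have hmod : σ ^ j = σ ^ (j % n) := by rw [← hord, pow_mod_orderOf]
    refine mul_eq_zero_of_left (Finset.prod_eq_zero (i := j % n) ?_ ?_) _
    · rw [Finset.mem_Ico]
      exact ⟨Nat.one_le_iff_ne_zero.2 fun h => hj (Nat.dvd_of_mod_eq_zero h), Nat.mod_lt _ hn⟩
    · rw [hmod, sub_self]
  -- averaging over the Galois group
  obtain ⟨u, hu⟩ := isUnit_mon_one hσn hn hG0
  have hconj : ∀ a : ℕ → L, polySum σ n G (n * G.natDegree) a ∈ I →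
      polySum σ n G (n * G.natDegree) (fun j => σ (a j)) ∈ I := by
    intro a ha
    have h1 := I.mul_mem_right _ (↑u⁻¹ : SkewQuot σ n G) (I.mul_mem_left (mon σ n G 1 1) _ ha)
    rwa [mon_one_mul_polySum, ← hu, Units.mul_inv_cancel_right] at h1
  have hgal : ∀ (τ : L ≃ₐ[K] L) (a : ℕ → L), polySum σ n G (n * G.natDegree) a ∈ I →
      polySum σ n G (n * G.natDegree) (fun j => τ (a j)) ∈ I := by
    intro τ a ha
    obtain ⟨l, rfl⟩ := (mem_powers_iff_mem_zpowers (G := L ≃ₐ[K] L)).2 (hσ τ)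
    induction l with
    | zero => simpa using ha
    | succ l ih =>
      have := hconj _ ih
      simpa only [pow_succ', AlgEquiv.mul_apply] using this
  have : Finite K := Finite.of_injective _ (algebraMap K L).injective
  obtain ⟨β, hβ⟩ : ∃ β, Algebra.trace K L (β * δ 0) ≠ 0 := by
    by_contra! h
    refine hδ0 ((traceForm_nondegenerate K L).2 _ fun β => ?_)
    exact h β
  have htr : polySum σ n G (n * G.natDegree)
      (fun j => algebraMap K L (Algebra.trace K L (β * δ j))) ∈ I := by
    have h1 : polySum σ n G (n * G.natDegree) (∑ τ : L ≃ₐ[K] L, fun j => τ (β * δ j)) ∈ I := by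
      rw [map_sum]
      refine sum_mem fun τ _ => hgal τ (fun j => β * δ j) ?_
      rw [← mon_mul_polySum_zero]
      exact I.mul_mem_left _ _ hprojn
    convert h1 using 2
    ext j
    rw [trace_eq_sum_automorphisms, Finset.sum_apply]
  rw [polySum_eq_polyHom hn _ _ (fun j _ hd => by rw [hδn j hd, mul_zero, map_zero])] at htr
  set P : K[X] := ∑ l ∈ Finset.range G.natDegree, C (Algebra.trace K L (β * δ (n * l))) * X ^ l
      with hP
  have hP0 : P ≠ 0 := by
    intro h
    have h1 : P.coeff 0 = Algebra.trace K L (β * δ 0) := by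
      rw [hP, finsetSum_coeff, Finset.sum_eq_single 0]
      · simp
      · intro l _ hl; simp [coeff_X_pow, hl.symm]
      · intro h; exact absurd (Finset.mem_range.2 hGd) h
    rw [h, coeff_zero] at h1
    exact hβ h1.symm
  have hdeg : P.degree < G.degree := by
    rw [degree_eq_natDegree hG.ne_zero, degree_lt_iff_coeff_zero]
    intro m hm
    rw [hP, finsetSum_coeff]
    refine Finset.sum_eq_zero fun l hl => ?_
    rw [coeff_C_mul_X_pow, if_neg (by have := Finset.mem_range.1 hl; omega)]
  have hunit : IsUnit (polyHom σ n G P) := isUnit_polyHom hσn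
    (((Irreducible.coprime_iff_not_dvd hirr).2 fun h => not_lt_of_ge (degree_le_of_dvd h hP0)
        hdeg).symm)
  obtain ⟨v, hv⟩ := hunit
  have := I.mul_mem_left (↑v⁻¹ : SkewQuot σ n G) _ htr
  rwa [← hv, Units.inv_mul] at this

theorem isSimpleRing_quot (hord : orderOf σ = n) (hσ : ∀ τ : L ≃ₐ[K] L, τ ∈ Subgroup.zpowers σ)
    (hn : 0 < n) (hG : G.Monic) (hirr : Irreducible G) (hG0 : G.coeff 0 ≠ 0) :
    IsSimpleRing (SkewQuot σ n G) := by
  have := nontrivial_quot (hord ▸ pow_orderOf_eq_one σ) hn hG hirr.natDegree_pos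
  refine ⟨⟨fun I => ?_⟩⟩
  by_cases h : ∃ b ∈ I, b ≠ 0
  · obtain ⟨b, hbI, hb⟩ := h
    exact Or.inr ((TwoSidedIdeal.one_mem_iff I).1 (one_mem_of_mem hord hσ hn hG hirr hG0 I hb hbI))
  · push Not at h
    left
    refine TwoSidedIdeal.ext fun x => ?_
    rw [TwoSidedIdeal.mem_bot]
    exact ⟨h x, fun hx => hx ▸ I.zero_mem⟩

/-- The center of `R_G` consists of the polynomials in `x ^ n` over `K`. -/
theorem center_quot (hord : orderOf σ = n) (hσ : ∀ τ : L ≃ₐ[K] L, τ ∈ Subgroup.zpowers σ)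
    (hn : 0 < n) (hG : G.Monic) (hG0 : G.coeff 0 ≠ 0) (hGd : 0 < G.natDegree) :
    Set.center (SkewQuot σ n G) = Set.range (polyHom σ n G) := by
  have hσn : σ ^ n = 1 := hord ▸ pow_orderOf_eq_one σ
  ext z
  rw [Semigroup.mem_center_iff]
  constructor
  · intro hz
    obtain ⟨γ, rfl⟩ := polySum_surjective (σ := σ) hn hG z
    obtain ⟨α, hα⟩ := exists_pow_fixed_imp σ
    have h1 : ∀ j < n * G.natDegree, ¬ n ∣ j → γ j = 0 := by
      intro j hj hd
      have h2 := hz (mon σ n G 0 α)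
      rw [mon_mul_polySum_zero, polySum_mul_mon_zero, ← sub_eq_zero, ← map_sub] at h2
      have h3 := polySum_eq_zero hσn hn hG hG0 hGd _ h2 j hj
      rw [Pi.sub_apply, ← sub_mul, mul_eq_zero, sub_eq_zero] at h3
      refine h3.resolve_left fun h => hd ?_
      rw [← hord]
      exact orderOf_dvd_of_pow_eq_one (hα j h.symm)
    have h4 : ∀ j < n * G.natDegree, σ (γ j) = γ j := by
      intro j hj
      have h2 := hz (mon σ n G 1 1)
      rw [mon_one_mul_polySum, (isUnit_mon_one hσn hn hG0).mul_left_inj, ← sub_eq_zero, ←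
          map_sub] at h2
      exact sub_eq_zero.1 (polySum_eq_zero hσn hn hG hG0 hGd _ h2 j hj)
    have : Finite K := Finite.of_injective _ (algebraMap K L).injective
    have h5 : ∀ j, ∃ c : K, j < n * G.natDegree → algebraMap K L c = γ j := by
      intro j
      by_cases hj : j < n * G.natDegree
      · have h6 : γ j ∈ (⊥ : IntermediateField K L) := by
          rw [IsGalois.mem_bot_iff_fixed]
          intro τ
          obtain ⟨l, rfl⟩ := (mem_powers_iff_mem_zpowers (G := L ≃ₐ[K] L)).2 (hσ τ)
          induction l with
          | zero => simp
          | succ l ih => 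
            change (σ ^ (l + 1)) (γ j) = γ j
            rw [pow_succ, AlgEquiv.mul_apply, h4 j hj]; exact ih
        obtain ⟨c, hc⟩ := IntermediateField.mem_bot.1 h6
        exact ⟨c, fun _ => hc⟩
      · exact ⟨0, fun h => absurd h hj⟩
    choose c hc using h5
    refine ⟨_, (polySum_eq_polyHom hn _ c fun j hj hd => ?_).symm.trans
      (polySum_congr fun j hj => hc j hj)⟩
    rw [← map_eq_zero (algebraMap K L), hc j hj, h1 j hj hd]
  · rintro ⟨P, rfl⟩ b
    exact (polyHom_mul_comm hσn P b).symm

theorem card_center_quot (hord : orderOf σ = n) (hσ : ∀ τ : L ≃ₐ[K] L, τ ∈ Subgroup.zpowers σ)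
    (hn : 0 < n) (hG : G.Monic) (hirr : Irreducible G) (hG0 : G.coeff 0 ≠ 0) :
    Nat.card (Set.center (SkewQuot σ n G)) = Nat.card K ^ G.natDegree := by
  have hσn : σ ^ n = 1 := hord ▸ pow_orderOf_eq_one σ
  have hnt := nontrivial_quot hσn hn hG hirr.natDegree_pos
  have hfact : Fact (Irreducible G) := ⟨hirr⟩
  let f : AdjoinRoot G →+* SkewQuot σ n G := Ideal.Quotient.lift _ (polyHom σ n G) (fun P hP => by
    obtain ⟨Q, rfl⟩ := Ideal.mem_span_singleton.1 hP
    rw [map_mul, polyHom_self, zero_mul])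
  have hf : ∀ P, f (AdjoinRoot.mk G P) = polyHom σ n G P := fun P => rfl
  have hrange : Set.range f = Set.range (polyHom σ n G) := by
    ext z
    constructor
    · rintro ⟨P, rfl⟩
      obtain ⟨P, rfl⟩ := AdjoinRoot.mk_surjective P
      exact ⟨P, rfl⟩
    · rintro ⟨P, rfl⟩
      exact ⟨AdjoinRoot.mk G P, rfl⟩
  have hfd : Module.finrank K (AdjoinRoot G) = G.natDegree := by
    rw [(AdjoinRoot.powerBasis hirr.ne_zero).finrank, AdjoinRoot.powerBasis_dim]
  have : Module.Finite K (AdjoinRoot G) := (AdjoinRoot.powerBasis hirr.ne_zero).finite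
  rw [center_quot hord hσ hn hG hG0 hirr.natDegree_pos, ← hrange,
    Nat.card_range_of_injective f.injective, Module.natCard_eq_pow_finrank (K := K), hfd]

/-- `R_G` is isomorphic to `M_n(E)`: it is finite and simple, hence a matrix ring over a finite
field, which is the center; the size of the matrices is found by counting. -/
theorem nonempty_ringEquiv {E : Type*} [Field E] [Finite E] (hord : orderOf σ = n)
    (hn : 0 < n) (hfr : Module.finrank K L = n)
    (hσ : ∀ τ : L ≃ₐ[K] L, τ ∈ Subgroup.zpowers σ) (hG : G.Monic) (hirr : Irreducible G)
    (hG0 : G.coeff 0 ≠ 0) (hE : Nat.card E = Nat.card K ^ G.natDegree) :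
    Nonempty (SkewQuot σ n G ≃+* Matrix (Fin n) (Fin n) E) := by
  have hσn : σ ^ n = 1 := hord ▸ pow_orderOf_eq_one σ
  have hsimple := isSimpleRing_quot hord hσ hn hG hirr hG0
  have hfin := finite_quot hσn hn hG hG0 hirr.natDegree_pos
  obtain ⟨r, hr, D, hD, ⟨e⟩⟩ := IsSimpleRing.exists_ringEquiv_matrix_divisionRing (SkewQuot σ n G)
  have hMfin : Finite (Matrix (Fin r) (Fin r) D) := Finite.of_equiv _ e.toEquiv
  have hDfin : Finite D := Finite.of_injective (Matrix.scalar (Fin r) : D → Matrix (Fin r) (Fin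
      r) D)
    fun _ _ h => Matrix.scalar_inj.1 h
  let : Field D := littleWedderburn D
  have hcenter : Nat.card (Set.center (SkewQuot σ n G)) = Nat.card D := by
    have h1 : Set.center (Matrix (Fin r) (Fin r) D) = e '' Set.center (SkewQuot σ n G) := by
      ext z
      obtain ⟨z, rfl⟩ := e.surjective z
      rw [e.injective.mem_set_image, Semigroup.mem_center_iff, Semigroup.mem_center_iff,
        e.surjective.forall]
      simp_rw [← map_mul, e.injective.eq_iff]
    rw [← Nat.card_image_of_injective e.injective, ← h1, Matrix.center_eq_range,
      Nat.card_range_of_injective fun _ _ h => Matrix.scalar_inj.1 h]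
  have hcard : Nat.card D = Nat.card E := by
    rw [← hcenter, card_center_quot hord hσ hn hG hirr hG0, hE]
  have := Fintype.ofFinite D
  have := Fintype.ofFinite E
  have eDE : D ≃+* E := FiniteField.ringEquivOfCardEq (by
    rwa [← Nat.card_eq_fintype_card, ← Nat.card_eq_fintype_card])
  have hrn : r = n := by
    have : Finite K := Finite.of_injective _ (algebraMap K L).injective
    have h1 := Nat.card_congr e.toEquiv
    rw [card_quot hσn hn hG hG0 hirr.natDegree_pos, Module.natCard_eq_pow_finrank (K := K) (V := L),
      hfr, ← pow_mul] at h1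
    have h2 : Nat.card (Matrix (Fin r) (Fin r) D) = (Nat.card K) ^ (G.natDegree * (r * r)) := by
      change Nat.card (Fin r → Fin r → D) = _
      rw [Nat.card_fun, Nat.card_fun, Nat.card_fin, hcard, hE, ← pow_mul, ← pow_mul]
    rw [h2] at h1
    have h3 := Nat.pow_right_injective (Finite.one_lt_card (α := K)) h1
    have h4 : r * r = n * n := by
      refine Nat.eq_of_mul_eq_mul_left hirr.natDegree_pos ?_
      rw [← h3]; ring
    exact Nat.mul_self_inj.1 h4
  subst hrn
  exact ⟨e.trans eDE.mapMatrix⟩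

end Galois

end SkewQuot

/-! ### Irreducibility of the reciprocal polynomial -/

namespace SkewQuot

section Reciprocal

variable {K : Type*} [Field K]

theorem isUnit_of_isUnit_reverse {a : K[X]} (h0 : a.coeff 0 ≠ 0) (h : IsUnit a.reverse) :
    IsUnit a := by
  have h1 := natDegree_eq_zero_of_isUnit h
  rw [reverse_natDegree, natTrailingDegree_eq_zero_of_constantCoeff_ne_zero h0, Nat.sub_zero] at h1
  rw [eq_C_of_natDegree_eq_zero h1]
  exact isUnit_C.2 h0.isUnit

theorem irreducible_reverse {F : K[X]} (hF : Irreducible F) (h0 : F.coeff 0 ≠ 0) :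
    Irreducible F.reverse := by
  have hrr : ∀ {a : K[X]}, a.coeff 0 ≠ 0 → a.reverse.reverse = a := by
    intro a ha
    have h1 : a.reverse.natDegree = a.natDegree := by
      rw [reverse_natDegree, natTrailingDegree_eq_zero_of_constantCoeff_ne_zero ha, Nat.sub_zero]
    rw [reverse, h1, reverse, reflect_reflect]
  have hc : F.reverse.coeff 0 ≠ 0 := by
    rw [coeff_zero_reverse]; exact leadingCoeff_ne_zero.2 hF.ne_zero
  refine ⟨fun h => hF.not_isUnit (isUnit_of_isUnit_reverse h0 h), fun a b hab => ?_⟩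
  rw [hab, mul_coeff_zero] at hc
  have h1 : F = a.reverse * b.reverse := by
    rw [← reverse_mul_of_domain, ← hab, hrr h0]
  exact (hF.isUnit_or_isUnit h1).imp (isUnit_of_isUnit_reverse (left_ne_zero_of_mul hc))
    (isUnit_of_isUnit_reverse (right_ne_zero_of_mul hc))

theorem irreducible_monicReciprocal {F : K[X]} (hF : Irreducible F) (h0 : F.coeff 0 ≠ 0) :
    Irreducible (monicReciprocal F) := by
  rw [monicReciprocal]
  exact (irreducible_isUnit_mul (isUnit_C.2 (inv_ne_zero h0).isUnit)).2 (irreducible_reverse hF h0)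

end Reciprocal

/-! ### The codes and their duals -/

variable {K L : Type*} [Field K] [Field L] [Algebra K L] {σ : L ≃ₐ[K] L} {n : ℕ} {G : K[X]}

theorem polySum_succ {N : ℕ} (hN : 0 < N) (a : ℕ → L) :
    polySum σ n G (N + 1) a = mk σ n G (skewMonomial σ 0 (a 0) +
      ∑ i ∈ Finset.Ico 1 N, skewMonomial σ i (a i) + skewMonomial σ N (a N)) := by
  rw [polySum_apply, Finset.sum_range_succ, Finset.range_eq_Ico, Finset.sum_eq_sum_Ico_succ_bot hN,
    map_add, map_add, map_sum]
  rfl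

theorem mem_polyCode_iff {N : ℕ} (hN : 0 < N) {Q : L → L → Prop} {b : SkewQuot σ n G} :
    b ∈ polyCode σ n G N Q ↔ ∃ u v, Q u v ∧ ∃ a : ℕ → L, b = mk σ n G (skewMonomial σ 0 u +
      ∑ i ∈ Finset.Ico 1 N, skewMonomial σ i (a i) + skewMonomial σ N v) := by
  constructor
  · rintro ⟨a, ha, rfl⟩
    exact ⟨a 0, a N, ha, a, polySum_succ hN a⟩
  · rintro ⟨u, v, huv, a, rfl⟩
    refine ⟨fun i => if i = 0 then u else if i = N then v else a i, by simpa [hN.ne'], ?_⟩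
    rw [polySum_succ hN]
    congr 3
    · refine Finset.sum_congr rfl fun i hi => ?_
      rw [Finset.mem_Ico] at hi
      rw [if_neg (by omega), if_neg (by omega)]
    · simp [hN.ne']

theorem codeS_eq_polyCode {s k : ℕ} (hN : 0 < s * k) (η : L) (ρ : L ≃+* L) :
    codeS σ n s k η ρ G = polyCode σ n G (s * k) (fun u v => v = η * ρ u) := by
  ext b
  rw [mem_polyCode_iff hN]
  constructor
  · rintro ⟨a, rfl⟩
    exact ⟨a 0, _, rfl, a, rfl⟩
  · rintro ⟨u, _, rfl, a, rfl⟩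
    refine ⟨fun i => if i = 0 then u else a i, ?_⟩
    congr 3
    refine Finset.sum_congr rfl fun i hi => ?_
    rw [Finset.mem_Ico] at hi
    simp only [if_neg (show i ≠ 0 by omega)]

theorem codeD_eq_polyCode {s k : ℕ} (hN : 0 < s * k) (γ : L) (M : IntermediateField K L) :
    codeD σ M n s k γ G =
      polyCode σ n G (s * k) (fun u v => u ∈ M ∧ ∃ w ∈ M, v = γ * w) := by
  ext b
  rw [mem_polyCode_iff hN]
  constructor
  · rintro ⟨a', a'', a, rfl⟩
    exact ⟨a', _, ⟨a'.2, a'', a''.2, rfl⟩, a, rfl⟩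
  · rintro ⟨u, _, ⟨hu, w, hw, rfl⟩, a, rfl⟩
    exact ⟨⟨u, hu⟩, ⟨w, hw⟩, a, rfl⟩

theorem mon_one_pow_mul_polySum (i N : ℕ) (a : ℕ → L) :
    mon σ n G 1 1 ^ i * polySum σ n G N a =
      polySum σ n G N (fun j => (σ ^ i) (a j)) * mon σ n G 1 1 ^ i := by
  induction i with
  | zero => simp
  | succ i ih =>
    rw [pow_succ', mul_assoc, ih, ← mul_assoc, mon_one_mul_polySum, mul_assoc, ← pow_succ']
    simp only [pow_succ' σ, AlgEquiv.mul_apply]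

/-- Multiplying a code by `c ∈ L` and conjugating with a power of `x` acts on the coefficients. -/
theorem conj_polyCode {u : (SkewQuot σ n G)ˣ} (hu : ↑u = mon σ n G 1 1) {c : L} (hc : c ≠ 0)
    (i N : ℕ) (Q : L → L → Prop) :
    (fun b => mon σ n G 1 1 ^ i * mon σ n G 0 c * b * ↑(u ^ i)⁻¹) '' polyCode σ n G N Q =
      polyCode σ n G N (fun v w => Q (c⁻¹ * (σ ^ i).symm v) (c⁻¹ * (σ ^ i).symm w)) := by
  have key : ∀ a, mon σ n G 1 1 ^ i * mon σ n G 0 c * polySum σ n G (N + 1) a * ↑(u ^ i)⁻¹ =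
      polySum σ n G (N + 1) (fun j => (σ ^ i) (c * a j)) := by
    intro a
    rw [mul_assoc (_ ^ i), mon_mul_polySum_zero, mon_one_pow_mul_polySum, ← hu, ←
        Units.val_pow_eq_pow_val,
      Units.mul_inv_cancel_right]
  ext z
  constructor
  · rintro ⟨_, ⟨a, ha, rfl⟩, rfl⟩
    refine ⟨_, ?_, key a⟩
    simpa only [AlgEquiv.symm_apply_apply, inv_mul_cancel_left₀ hc] using ha
  · rintro ⟨a, ha, rfl⟩
    refine ⟨_, ⟨fun j => c⁻¹ * (σ ^ i).symm (a j), ha, rfl⟩, ?_⟩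
    refine (key _).trans ?_
    simp only [mul_inv_cancel_left₀ hc, AlgEquiv.apply_symm_apply]

/-- The dual of a code with boundary condition `Q` is equivalent to the code in the quotient ring of
the reciprocal polynomial with the orthogonal boundary condition. -/
theorem codeEquivalent_dualCode_polyCode {E : Type*} [Field E] [Finite E] {p : ℕ} [Fact p.Prime]
    [Algebra (ZMod p) E] (hσ : σ ^ n = 1) (hn : 0 < n) {F : K[X]} (hF : F.Monic)
    (h0 : F.coeff 0 ≠ 0) (hFd : 0 < F.natDegree) {N N' : ℕ} (hN : N + N' = n * F.natDegree)
    (hN0 : 0 < N) (t : L →+ ZMod p) (htσ : ∀ a, t (σ a) = t a)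
    (ht : ∀ a, (∀ b, t (b * a) = 0) → a = 0) {Q : L → L → Prop} (hQ : Q 0 0)
    (m : SkewQuot σ n F ≃+* Matrix (Fin n) (Fin n) E)
    (m' : SkewQuot σ n (monicReciprocal F) ≃+* Matrix (Fin n) (Fin n) E) :
    CodeEquivalent (dualCode (m '' polyCode σ n F N Q))
      (m' '' polyCode σ n (monicReciprocal F) N' (fun u v => ∀ a b, Q a b →
        t (a * v) = t (algebraMap K L (F.coeff 0) * b * u))) := by
  obtain ⟨y, φ, hy, hφ⟩ := exists_antiHom_reciprocal (σ := σ) hσ hn h0 hF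
  have hF0 : (monicReciprocal F).coeff 0 ≠ 0 := by
    rw [monicReciprocal_coeff_zero hF]; exact inv_ne_zero h0
  obtain ⟨u, hu⟩ := isUnit_mon_one (σ := σ) hσ hn hF0
  let T : SkewQuot σ n F →+ ZMod p := t.comp (constCoeff hσ hn hF)
  have hT0 : ∃ a, T a ≠ 0 := by
    by_contra! h
    refine one_ne_zero (α := L) (ht 1 fun b => ?_)
    have h1 := h (mon σ n F 0 b)
    have h2 : remCoeff F 1 = 1 := by simpa using remCoeff_X_pow_of_lt hF hFd
    change t (constCoeff hσ hn hF (mon σ n F 0 b)) = 0 at h1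
    rw [constCoeff_mon] at h1
    simpa [h2] using h1
  have h1 := MatrixCode.codeEquivalent_dualCode hn m m' φ T (constCoeff_mul_comm hσ hn hF t htσ) hT0
    (polyCode σ n F N Q)
  have h2 := orthogonal_polyCode hσ hn hF h0 hFd hN hN0 t ht hQ
  change CodeEquivalent _ (m' '' ((fun b => (φ b).unop) ''
    {b | ∀ a ∈ polyCode σ n F N Q, t (constCoeff hσ hn hF (a * b)) = 0})) at h1
  rw [h2] at h1
  refine MatrixCode.codeEquivalent_mul_units m' 1 (u ^ N') h1 ?_
  rw [Set.image_image]
  simp only [Units.val_one, one_mul, Units.val_pow_eq_pow_val, hu, mon_pow]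
  refine Eq.trans ?_ (antiHom_polyCode hy hφ N' _).symm
  congr! 6 with u v
  rw [← AlgEquiv.mul_apply, ← pow_add, hN, pow_mul_apply_eq hσ]

/-- For `[L : M] = 2`, the orthogonal of `M` with respect to the trace form of `L` over the prime
field is a line `δ M`, the kernel of the trace of `L / M`. -/
theorem exists_orthogonal_eq_mul [Finite L] [FiniteDimensional K L] {p : ℕ} [Fact p.Prime]
    [Algebra (ZMod p) L] (M : IntermediateField K L) (hM : Module.finrank M L = 2) :
    ∃ δ : L, δ ≠ 0 ∧ ∀ v, (∀ a ∈ M, Algebra.trace (ZMod p) L (a * v) = 0) ↔ ∃ w ∈ M, v = δ * w := by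
  have : CharP L p := charP_of_injective_algebraMap (algebraMap (ZMod p) L).injective p
  have : CharP M p := (algebraMap M L).charP_iff_charP p |>.2 this
  let : Algebra (ZMod p) M := ZMod.algebra M p
  have : @IsScalarTower (ZMod p) M L Algebra.toSMul Algebra.toSMul Algebra.toSMul :=
    IsScalarTower.of_algebraMap_eq' (Subsingleton.elim _ _)
  have hker : Module.finrank M (LinearMap.ker (Algebra.trace M L)) = 1 := by
    have h1 := LinearMap.finrank_range_add_finrank_ker (Algebra.trace M L)
    rw [LinearMap.range_eq_top.2 (Algebra.trace_surjective M L), finrank_top,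
        Module.finrank_self, hM] at h1
    omega
  obtain ⟨⟨δ, hδ⟩, hδ0, hspan⟩ := finrank_eq_one_iff'.1 hker
  refine ⟨δ, fun h => hδ0 (Subtype.ext h), fun v => ?_⟩
  have h1 : (∀ a ∈ M, Algebra.trace (ZMod p) L (a * v) = 0) ↔ Algebra.trace M L v = 0 := by
    have h2 : ∀ a : M, Algebra.trace (ZMod p) L ((a : L) * v) =
        Algebra.trace (ZMod p) M (a * Algebra.trace M L v) := by
      intro a
      rw [← Algebra.trace_trace (S := M), ← smul_eq_mul a, ← map_smul, Algebra.smul_def]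
      rfl
    constructor
    · intro h
      refine (traceForm_nondegenerate (ZMod p) M).2 _ fun a => ?_
      rw [Algebra.traceForm_apply, ← h2]
      exact h a a.2
    · intro h a ha
      rw [h2 ⟨a, ha⟩, h, mul_zero, map_zero]
  rw [h1]
  constructor
  · intro h
    obtain ⟨c, hc⟩ := hspan ⟨v, h⟩
    refine ⟨c, c.2, ?_⟩
    rw [mul_comm]
    exact (congrArg Subtype.val hc).symm
  · rintro ⟨w, hw, rfl⟩
    have : δ * w = (⟨w, hw⟩ : M) • δ := by rw [mul_comm]; rfl
    rw [this, map_smul, LinearMap.mem_ker.1 hδ, smul_zero]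

/-- Every automorphism of `L / K` maps an intermediate field of finite fields onto itself. -/
theorem apply_mem_iff [Finite L] [FiniteDimensional K L] (M : IntermediateField K L) (τ : L ≃ₐ[K] L)
    (x : L) : τ x ∈ M ↔ x ∈ M := by
  have : Finite K := Finite.of_injective _ (algebraMap K L).injective
  have h := IntermediateField.normal_iff_forall_map_eq'.1 (inferInstance : Normal K M) τ
  constructor
  · intro hx
    rw [← h] at hx
    obtain ⟨y, hy, hyx⟩ := hx
    rwa [← τ.injective hyx]
  · intro hx
    rw [← h]
    exact ⟨x, hx, rfl⟩

theorem trace_zmod_apply [Finite L] {p : ℕ} [Fact p.Prime] [Algebra (ZMod p) L] (ρ : L ≃+* L)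
    (a : L) :
    Algebra.trace (ZMod p) L (ρ a) = Algebra.trace (ZMod p) L a :=
  Algebra.trace_eq_of_algEquiv (AlgEquiv.ofRingEquiv (f := ρ) fun c =>
    RingHom.congr_fun (Subsingleton.elim (ρ.toRingHom.comp (algebraMap (ZMod p) L)) _) c) a

theorem codeEquivalent_dualCode_codeS [Finite L]
    {E : Type*} [Field E] [Finite E] {p : ℕ} [Fact p.Prime] [Algebra (ZMod p) L]
    [Algebra (ZMod p) E] (hσn : σ ^ n = 1) {F : K[X]} (hF : F.Monic) (h0 : F.coeff 0 ≠ 0)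
    (hFd : 0 < F.natDegree) {k : ℕ} (hk : 1 ≤ k) (hkn : k < n)
    (m : SkewQuot σ n F ≃+* Matrix (Fin n) (Fin n) E)
    (m' : SkewQuot σ n (monicReciprocal F) ≃+* Matrix (Fin n) (Fin n) E) (η : L) (ρ : L ≃+* L) :
    CodeEquivalent (dualCode (m '' codeS σ n F.natDegree k η ρ F))
      (m' '' codeS σ n F.natDegree (n - k) (ρ.symm (η * algebraMap K L (F.coeff 0))) ρ.symm
        (monicReciprocal F)) := by
  have hn0 : 0 < n := by omega
  have hNpos : 0 < F.natDegree * k := Nat.mul_pos hFd hk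
  have hN'pos : 0 < F.natDegree * (n - k) := Nat.mul_pos hFd (by omega)
  have hNN : F.natDegree * k + F.natDegree * (n - k) = n * F.natDegree := by
    rw [← mul_add, Nat.add_sub_cancel' hkn.le, mul_comm]
  let t : L →+ ZMod p := (Algebra.trace (ZMod p) L).toAddMonoidHom
  have htρ : ∀ (ρ : L ≃+* L) a, t (ρ a) = t a := fun ρ a => trace_zmod_apply ρ a
  have htnd : ∀ a, (∀ b, t (b * a) = 0) → a = 0 := fun a ha =>
    (traceForm_nondegenerate (ZMod p) L).2 a ha
  rw [codeS_eq_polyCode hNpos, codeS_eq_polyCode hN'pos]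
  have h := codeEquivalent_dualCode_polyCode hσn hn0 hF h0 hFd hNN hNpos t
    (fun a => htρ σ.toRingEquiv a) htnd (Q := fun u v => v = η * ρ u) (by simp) m m'
  convert h using 5 with u v
  have h1 : ∀ a, t (algebraMap K L (F.coeff 0) * (η * ρ a) * u) =
      t (a * (ρ.symm (η * algebraMap K L (F.coeff 0)) * ρ.symm u)) := by
    intro a
    rw [← htρ ρ.symm]
    congr 1
    rw [map_mul ρ.symm, map_mul ρ.symm, map_mul ρ.symm, map_mul ρ.symm, ρ.symm_apply_apply]
    ring
  refine ⟨?_, fun h2 => ?_⟩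
  · rintro rfl a _ rfl
    exact (h1 a).symm
  · refine sub_eq_zero.1 (htnd _ fun a => ?_)
    rw [mul_sub, map_sub, h2 a _ rfl, h1, sub_self]

/-- The orthogonal boundary condition of `D(γ)` is `u ∈ γ⁻¹ δ M`, `v ∈ δ M`, where `δ M` is the
orthogonal of `M`; multiplying by `δ⁻¹ γ` gives `D(γ)`, and conjugating with `x ^ (s k)` gives
`D(σ ^ (s k) γ)`. -/
theorem codeEquivalent_dualCode_codeD [Finite L] [FiniteDimensional K L]
    {E : Type*} [Field E] [Finite E] {p : ℕ} [Fact p.Prime] [Algebra (ZMod p) L]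
    [Algebra (ZMod p) E] (hσn : σ ^ n = 1) {F : K[X]} (hF : F.Monic) (h0 : F.coeff 0 ≠ 0)
    (hFd : 0 < F.natDegree) {k : ℕ} (hk : 1 ≤ k) (hkn : k < n)
    (m : SkewQuot σ n F ≃+* Matrix (Fin n) (Fin n) E)
    (m' : SkewQuot σ n (monicReciprocal F) ≃+* Matrix (Fin n) (Fin n) E)
    (hfr : Module.finrank K L = n) {t' : ℕ} {M : IntermediateField K L} {γ : L} (ht' : n = 2 * t')
    (hMt : Module.finrank K M = t') (hγ : γ ≠ 0) :
    CodeEquivalent (dualCode (m '' codeD σ M n F.natDegree k γ F))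
      (m' '' codeD σ M n F.natDegree (n - k) ((σ ^ (F.natDegree * k)) γ) (monicReciprocal F)) := by
  have hn0 : 0 < n := by omega
  have hNpos : 0 < F.natDegree * k := Nat.mul_pos hFd hk
  have hN'pos : 0 < F.natDegree * (n - k) := Nat.mul_pos hFd (by omega)
  have hNN : F.natDegree * k + F.natDegree * (n - k) = n * F.natDegree := by
    rw [← mul_add, Nat.add_sub_cancel' hkn.le, mul_comm]
  let t : L →+ ZMod p := (Algebra.trace (ZMod p) L).toAddMonoidHom
  have htρ : ∀ (ρ : L ≃+* L) a, t (ρ a) = t a := fun ρ a => trace_zmod_apply ρ a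
  have htnd : ∀ a, (∀ b, t (b * a) = 0) → a = 0 := fun a ha =>
    (traceForm_nondegenerate (ZMod p) L).2 a ha
  have ht_apply : ∀ a, t a = Algebra.trace (ZMod p) L a := fun _ => rfl
  have hc0 : algebraMap K L (F.coeff 0) ≠ 0 := by simpa using h0
  have hF0 : (monicReciprocal F).coeff 0 ≠ 0 := by
    rw [monicReciprocal_coeff_zero hF]; exact inv_ne_zero h0
  rw [codeD_eq_polyCode hNpos, codeD_eq_polyCode hN'pos]
  have h := codeEquivalent_dualCode_polyCode hσn hn0 hF h0 hFd hNN hNpos t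
    (fun a => htρ σ.toRingEquiv a) htnd (Q := fun u v => u ∈ M ∧ ∃ w ∈ M, v = γ * w)
    ⟨M.zero_mem, 0, M.zero_mem, by simp⟩ m m'
  have hM2 : Module.finrank M L = 2 := by
    have h1 := Module.finrank_mul_finrank K M L
    rw [hMt, hfr, ht', mul_comm] at h1
    exact Nat.eq_of_mul_eq_mul_right (by omega) h1
  obtain ⟨δ, hδ0, hδ⟩ := exists_orthogonal_eq_mul (p := p) M hM2
  obtain ⟨u, hu⟩ := isUnit_mon_one (σ := σ) hσn hn0 hF0
  have hc : δ⁻¹ * γ ≠ 0 := mul_ne_zero (inv_ne_zero hδ0) hγ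
  have hcu : IsUnit (mon σ n (monicReciprocal F) 0 (δ⁻¹ * γ)) :=
    ⟨⟨_, mon σ n (monicReciprocal F) 0 (δ⁻¹ * γ)⁻¹,
      by rw [mon_mul_mon, pow_zero, AlgEquiv.one_apply, mul_inv_cancel₀ hc, mon_zero_one],
      by rw [mon_mul_mon, pow_zero, AlgEquiv.one_apply, inv_mul_cancel₀ hc, mon_zero_one]⟩, rfl⟩
  obtain ⟨v, hv⟩ := hcu
  refine MatrixCode.codeEquivalent_mul_units m' (u ^ (F.natDegree * k) * v)
    (u ^ (F.natDegree * k))⁻¹ h ?_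
  rw [Units.val_mul, Units.val_pow_eq_pow_val, hv]
  conv_rhs => rw [hu]
  rw [conj_polyCode hu hc]
  congr 1
  ext x y
  -- the boundary condition splits into orthogonality conditions for the two coefficients
  have hsplit : ∀ x y : L, (∀ a b, (a ∈ M ∧ ∃ w ∈ M, b = γ * w) →
      t (a * y) = t (algebraMap K L (F.coeff 0) * b * x)) ↔
      (∃ w ∈ M, γ * x = δ * w) ∧ (∃ w ∈ M, y = δ * w) := by
    intro x y
    rw [← hδ, ← hδ]
    constructor
    · intro h1
      refine ⟨fun a ha => ?_, fun a ha => ?_⟩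
      · have h2 := h1 0 (γ * (algebraMap K L (F.coeff 0)⁻¹ * a))
          ⟨M.zero_mem, _, M.mul_mem (M.algebraMap_mem _) ha, rfl⟩
        rw [zero_mul, map_zero] at h2
        rw [← ht_apply, h2]
        congr 1
        rw [map_inv₀]
        field_simp
      · have h2 := h1 a 0 ⟨ha, 0, M.zero_mem, by simp⟩
        rwa [mul_zero, zero_mul, map_zero] at h2
    · rintro ⟨h1, h2⟩ a b ⟨ha, w, hw, rfl⟩
      have h3 := h1 _ (M.mul_mem (M.algebraMap_mem (F.coeff 0)) hw)
      rw [ht_apply, ht_apply, h2 a ha, ← h3]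
      congr 1
      ring
  rw [hsplit]
  set N := F.natDegree * k
  constructor
  · rintro ⟨hx, w, hw, rfl⟩
    refine ⟨⟨(σ ^ N).symm x, ?_, ?_⟩, ⟨(σ ^ N).symm w, ?_, ?_⟩⟩
    · rwa [← apply_mem_iff M (σ ^ N), AlgEquiv.apply_symm_apply]
    · field_simp
    · rwa [← apply_mem_iff M (σ ^ N), AlgEquiv.apply_symm_apply]
    · rw [map_mul, AlgEquiv.symm_apply_apply]; field_simp
  · rintro ⟨⟨w, hw, h1⟩, ⟨w', hw', h2⟩⟩
    refine ⟨?_, (σ ^ N) w', (apply_mem_iff M _ _).2 hw', ?_⟩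
    · have h3 : (σ ^ N).symm x = w := by
        field_simp at h1
        exact h1
      rw [(AlgEquiv.symm_apply_eq _).1 h3]
      exact (apply_mem_iff M _ _).2 hw
    · rw [← map_mul, ← AlgEquiv.symm_apply_eq]
      field_simp at h2
      exact h2

end SkewQuot

open SkewQuot in
theorem mainTheorem2 {K L E : Type*} [Field K] [Finite K] [Field L] [Algebra K L]
    [FiniteDimensional K L] [Field E] [Finite E]
    (n s k : ℕ) (hn : Module.finrank K L = n)
    (σ : L ≃ₐ[K] L) (hσ : ∀ τ : L ≃ₐ[K] L, τ ∈ Subgroup.zpowers σ)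
    (F : K[X]) (hF_monic : F.Monic) (hF_irr : Irreducible F) (hF_zero : F.coeff 0 ≠ 0)
    (hs : F.natDegree = s) (hk : 1 ≤ k) (hkn : k < n)
    (hE : Nat.card E = Nat.card K ^ s) :
    Nonempty (SkewQuot σ n F ≃+* Matrix (Fin n) (Fin n) E) ∧
    Nonempty (SkewQuot σ n (monicReciprocal F) ≃+* Matrix (Fin n) (Fin n) E) ∧
    ∀ (m : SkewQuot σ n F ≃+* Matrix (Fin n) (Fin n) E)
      (m' : SkewQuot σ n (monicReciprocal F) ≃+* Matrix (Fin n) (Fin n) E),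
      (∀ (η : L) (ρ : L ≃+* L),
        CodeEquivalent
          (dualCode (m '' codeS σ n s k η ρ F))
          (m' '' codeS σ n s (n - k) (ρ.symm (η * algebraMap K L (F.coeff 0))) ρ.symm
            (monicReciprocal F))) ∧
      (∀ (t : ℕ) (M : IntermediateField K L) (γ : L),
        n = 2 * t → Module.finrank K M = t → γ ≠ 0 →
        CodeEquivalent
          (dualCode (m '' codeD σ M n s k γ F))
          (m' '' codeD σ M n s (n - k) ((σ ^ (s * k)) γ) (monicReciprocal F))) := by
  have hL : Finite L := Module.finite_of_finite K
  have hn0 : 0 < n := by omega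
  have hord : orderOf σ = n := orderOf_eq_finrank hn hσ
  have hσn : σ ^ n = 1 := hord ▸ pow_orderOf_eq_one σ
  have hFd : 0 < F.natDegree := hF_irr.natDegree_pos
  have hF0 : (monicReciprocal F).coeff 0 ≠ 0 := by
    rw [monicReciprocal_coeff_zero hF_monic]; exact inv_ne_zero hF_zero
  subst hs
  refine ⟨nonempty_ringEquiv hord hn0 hn hσ hF_monic hF_irr hF_zero hE,
    nonempty_ringEquiv hord hn0 hn hσ (monicReciprocal_monic hF_zero)
      (irreducible_monicReciprocal hF_irr hF_zero) hF0 (by rwa [monicReciprocal_natDegree hF_zero]),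
    fun m m' => ?_⟩
  obtain ⟨p, hp⟩ := CharP.exists K
  have hpp : Fact p.Prime := ⟨CharP.char_is_prime K p⟩
  have hpL : CharP L p := charP_of_injective_algebraMap (algebraMap K L).injective p
  have hpE : CharP E p := by
    obtain ⟨l, hl⟩ : ∃ l, Nat.card K = p ^ l := by
      have := Fintype.ofFinite K
      obtain ⟨l, -, hl⟩ := FiniteField.card K p
      exact ⟨l, by rw [Nat.card_eq_fintype_card, hl]⟩
    have h1 : ((Nat.card E : ℕ) : E) = 0 := by
      have := Fintype.ofFinite E
      rw [Nat.card_eq_fintype_card]; exact Nat.cast_card_eq_zero E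
    rw [hE, hl, ← pow_mul, Nat.cast_pow] at h1
    exact (CharP.charP_iff_prime_eq_zero hpp.out).2 (by_contra fun h => pow_ne_zero _ h h1)
  let : Algebra (ZMod p) L := ZMod.algebra L p
  let : Algebra (ZMod p) E := ZMod.algebra E p
  exact ⟨fun η ρ => codeEquivalent_dualCode_codeS (p := p) hσn hF_monic hF_zero hFd hk hkn m m' η ρ,
    fun _ _ _ ht' hMt hγ => codeEquivalent_dualCode_codeD (p := p) hσn hF_monic hF_zero hFd hk hkn
      m m' hn ht' hMt hγ⟩
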